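/- **Setting.** A monoidal signature consists of a set of sorts and of symbols $s\colon U\to V$, where $U,V$ are monomials, i.e. words of sorts (read as $\otimes$-products; the empty word is $1$). Polynomials are words of monomials (read as $\oplus$-sums; the empty word is $0$). *Circuits* $c\colon U\to V$ are generated by the symbols and, for each sort $A$, the copier $A\to A\otimes A$, discharger $A\to 1$, cocopier $A\otimes A\to A$ and codischarger $1\to A$, with identities, symmetries, composition $;$ and $\otimes$. *Tapes* $t\colon P\to Q$ between polynomials are generated by the circuits and, for each monomial $U$, $\lhd_U\colon U\to U\oplus U$, $U\to 0$, $\rhd_U\colon U\oplus U\to U$ and $0\to U$, with identities, symmetries, $;$, $\oplus$ and the trace $\mathrm{tr}_U(t)\colon P\to Q$ of $t\colon U\oplus P\to U\oplus Q$; the product $\otimes$ of tapes, the (co)monoids of $\otimes$ and $\oplus$ on arbitrary monomials and polynomials, and traces along polynomials are derived by the usual inductive definitions. The Kleene star of $t\colon P\to P$ is $t^*=\mathrm{tr}_P((t\oplus\mathrm{id}_P);\rhd_P;\lhd_P)$, and the opposite $c^\circ\colon V\to U$ of a circuit $c\colon U\to V$ is obtained by bending its wires with the (co)copiers and (co)dischargers.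 A *Kleene-Cartesian theory* $(\Sigma,\mathbb I)$ is a monoidal signature $\Sigma$ together with a set $\mathbb I$ of pairs of tapes of equal type. The induced order $\leq_{\mathbb I}$ is the smallest preorder on tapes of equal type that contains $\mathbb I$ and the axioms of Kleene-Cartesian rig categories (the laws of Cartesian bicategories for $\otimes$ on circuits; the laws of traced symmetric monoidal categories for $\oplus$; naturality and commutativity of the monoids and comonoids of $\oplus$, which form bialgebras, with the monoid operations left adjoint to the corresponding comonoid operations; and $\mathrm{tr}_U(\rhd_U;\lhd_U)=\mathrm{id}_U$), that is preserved by $;$, $\oplus$ and $\otimes$, and that is closed under posetal uniformity: for $t_1\colon R_1\oplus P\to R_1\oplus Q$ and $t_2\colon R_2\oplus P\to R_2\oplus Q$, * if $r_2\leq r_1\colon R_1\to R_2$ and $t_1;(r_1\oplus\mathrm{id}_Q)\leq(r_2\oplus\mathrm{id}_P);t_2$, then $\mathrm{tr}_{R_1}t_1\leq\mathrm{tr}_{R_2}t_2$; * if $r_2\leq r_1\colon R_2\to R_1$ and $(r_1\oplus\mathrm{id}_P);t_1\leq t_2;(r_2\oplus\mathrm{id}_Q)$, then $\mathrm{tr}_{R_1}t_1\leq\mathrm{tr}_{R_2}t_2$.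 An *interpretation* of $\Sigma$ in $\mathbf{Rel}$ assigns a set to every sort and, to every symbol, a relation between the corresponding finite products. It induces a relation $[\![t]\!]\subseteq[\![P]\!]\times[\![Q]\!]$ for every tape $t\colon P\to Q$: $\otimes$ is the Cartesian product and $\oplus$ the disjoint union; the copier and the discharger are the diagonal function and the unique function to the one-point set, the cocopier and the codischarger are their converses; $\rhd_U$ is the codiagonal function of the disjoint union and $\lhd_U$ its converse, while $U\to0$ and $0\to U$ are empty; and the trace of $f\subseteq(U\oplus P)\times(U\oplus Q)$ is $f_{PQ}\cup(f_{PU};f_{UU}^{\,*};f_{UQ})$, where $f_{XY}$ denotes the restriction of $f$ to $X\times Y$ and $f_{UU}^{\,*}$ is the reflexive-transitive closure of $f_{UU}$. The interpretation is a *model* of $(\Sigma,\mathbb I)$ if $t\leq_{\mathbb I}t'$ implies $[\![t]\!]\subseteq[\![t']\!]$. **The Kleene-Cartesian theory of Peano** $(\Sigma,\mathbb P)$ has one sort $A$, symbols $0\colon1\to A$ and $s\colon A\to A$, and, with $[s,0]=(s\oplus0);\rhd_A\colon A\oplus1\to A$ and $[s,0]^\circ=\lhd_A;(s^\circ\oplus0^\circ)\colon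 A\to A\oplus1$, the axioms $$[s,0]^\circ;[s,0]=\mathrm{id}_A,\qquad [s,0];[s,0]^\circ=\mathrm{id}_{A\oplus1},\qquad \text{codischarger}_A\leq 0;s^*\ \colon 1\to A .$$ An interpretation of $\Sigma$ in $\mathbf{Rel}$ is thus a set $X$ with relations $0\subseteq1\times X$ and $s\subseteq X\times X$. **Theorem.** The set $\mathbb N$ with the element zero and the graph of the successor function is a model of $(\Sigma,\mathbb P)$ in $\mathbf{Rel}$, and every model $(X,0,s)$ of $(\Sigma,\mathbb P)$ in $\mathbf{Rel}$ is isomorphic to it: there is a bijection $e\colon X\to\mathbb N$ such that $(\ast,x)\in 0$ if and only if $e(x)=0$, and $(x,y)\in s$ if and only if $e(y)=e(x)+1$. -/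

import Mathlib

universe u v

namespace KleeneCartesian

/-! ### Monoidal signatures, words and polynomials

A monomial is a word `U` of sorts, read as the `⊗`-product of its letters (the empty word is `1`).
A polynomial is a word `P` of words, read as the `⊕`-sum of its monomials (the empty word is `0`).
On words `⊗` is concatenation; on polynomials `⊕` is concatenation. -/

structure MonSig where
  Srt : Type
  Op : Type
  ar : Op → List Srt
  coar : Op → List Srt

abbrev Mono (S : MonSig) : Type := List S.Srt

abbrev Poly (S : MonSig) : Type := List (List S.Srt)

/-- The product `(⊕ᵢ Uᵢ) ⊗ (⊕ⱼ Vⱼ) = ⊕ᵢ ⊕ⱼ Uᵢ Vⱼ` of polynomials. -/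
def Poly.mul {S : MonSig} (P Q : Poly S) : Poly S :=
  P.flatMap (fun U => Q.map (fun V => U ++ V))

/-! ### Circuits and tapes (raw terms) -/

/-- Circuits. `idA A` is the identity of the sort `A`, `idOne` the identity of `1`. -/
inductive Circ (S : MonSig) : Type where
  | idA (A : S.Srt)
  | idOne
  | gen (s : S.Op)
  | symm (A B : S.Srt)
  | seq (c d : Circ S)
  | ten (c d : Circ S)
  | discard (A : S.Srt)
  | copy (A : S.Srt)
  | codiscard (A : S.Srt)
  | cocopy (A : S.Srt)

/-- Tapes. `bang, diag, cobang, codiag` are the (co)monoid structure of `⊕`; `tr U t` is the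
trace of `t : U ⊕ P → U ⊕ Q` along the monomial `U`. -/
inductive Tape (S : MonSig) : Type where
  | idU (U : Mono S)
  | idZero
  | circ (c : Circ S)
  | symm (U V : Mono S)
  | seq (t s : Tape S)
  | par (t s : Tape S)
  | bang (U : Mono S)
  | diag (U : Mono S)
  | cobang (U : Mono S)
  | codiag (U : Mono S)
  | tr (U : Mono S) (t : Tape S)

infixl:60 " ⨟ " => Circ.seq
infixl:65 " ⊠ " => Circ.ten
infixl:60 " ⨟ₜ " => Tape.seq
infixl:65 " ⊞ₜ " => Tape.par

variable {S : MonSig}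

/-! ### Type system -/

inductive Circ.HasType : Circ S → Mono S → Mono S → Prop where
  | idA (A : S.Srt) : HasType (.idA A) [A] [A]
  | idOne : HasType .idOne [] []
  | gen (s : S.Op) : HasType (.gen s) (S.ar s) (S.coar s)
  | symm (A B : S.Srt) : HasType (.symm A B) [A, B] [B, A]
  | seq {c d : Circ S} {U V W : Mono S} :
      HasType c U V → HasType d V W → HasType (c ⨟ d) U W
  | ten {c d : Circ S} {U₁ V₁ U₂ V₂ : Mono S} :
      HasType c U₁ V₁ → HasType d U₂ V₂ → HasType (c ⊠ d) (U₁ ++ U₂) (V₁ ++ V₂)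
  | discard (A : S.Srt) : HasType (.discard A) [A] []
  | copy (A : S.Srt) : HasType (.copy A) [A] [A, A]
  | codiscard (A : S.Srt) : HasType (.codiscard A) [] [A]
  | cocopy (A : S.Srt) : HasType (.cocopy A) [A, A] [A]

inductive Tape.HasType : Tape S → Poly S → Poly S → Prop where
  | idU (U : Mono S) : HasType (.idU U) [U] [U]
  | idZero : HasType .idZero [] []
  | circ {c : Circ S} {U V : Mono S} : c.HasType U V → HasType (.circ c) [U] [V]
  | symm (U V : Mono S) : HasType (.symm U V) [U, V] [V, U]
  | seq {t s : Tape S} {P Q R : Poly S} :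
      HasType t P Q → HasType s Q R → HasType (t ⨟ₜ s) P R
  | par {t s : Tape S} {P₁ Q₁ P₂ Q₂ : Poly S} :
      HasType t P₁ Q₁ → HasType s P₂ Q₂ → HasType (t ⊞ₜ s) (P₁ ++ P₂) (Q₁ ++ Q₂)
  | bang (U : Mono S) : HasType (.bang U) [U] []
  | diag (U : Mono S) : HasType (.diag U) [U] [U, U]
  | cobang (U : Mono S) : HasType (.cobang U) [] [U]
  | codiag (U : Mono S) : HasType (.codiag U) [U, U] [U]
  | tr {U : Mono S} {t : Tape S} {P Q : Poly S} :
      HasType t (U :: P) (U :: Q) → HasType (.tr U t) P Q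

/-! Source and target of a raw term; on well-typed terms they are the unique type
(`Tape.HasType.dom_cod` below). -/

def Circ.dom : Circ S → Mono S
  | .idA A => [A]
  | .idOne => []
  | .gen s => S.ar s
  | .symm A B => [A, B]
  | .seq c _ => c.dom
  | .ten c d => c.dom ++ d.dom
  | .discard A => [A]
  | .copy A => [A]
  | .codiscard _ => []
  | .cocopy A => [A, A]

def Circ.cod : Circ S → Mono S
  | .idA A => [A]
  | .idOne => []
  | .gen s => S.coar s
  | .symm A B => [B, A]
  | .seq _ d => d.cod
  | .ten c d => c.cod ++ d.cod
  | .discard _ => []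
  | .copy A => [A, A]
  | .codiscard A => [A]
  | .cocopy A => [A]

def Tape.dom : Tape S → Poly S
  | .idU U => [U]
  | .idZero => []
  | .circ c => [c.dom]
  | .symm U V => [U, V]
  | .seq t _ => t.dom
  | .par t s => t.dom ++ s.dom
  | .bang U => [U]
  | .diag U => [U]
  | .cobang _ => []
  | .codiag U => [U, U]
  | .tr _ t => t.dom.tail

def Tape.cod : Tape S → Poly S
  | .idU U => [U]
  | .idZero => []
  | .circ c => [c.cod]
  | .symm U V => [V, U]
  | .seq _ s => s.cod
  | .par t s => t.cod ++ s.cod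
  | .bang _ => []
  | .diag U => [U, U]
  | .cobang U => [U]
  | .codiag U => [U]
  | .tr _ t => t.cod.tail

theorem Circ.HasType.dom_cod {c : Circ S} {U V : Mono S} (h : c.HasType U V) :
    c.dom = U ∧ c.cod = V := by
  induction h <;> simp_all [Circ.dom, Circ.cod]

theorem Tape.HasType.dom_cod {t : Tape S} {P Q : Poly S} (h : t.HasType P Q) :
    t.dom = P ∧ t.cod = Q := by
  induction h with
  | circ hc => simp [Tape.dom, Tape.cod, hc.dom_cod.1, hc.dom_cod.2]
  | _ => simp_all [Tape.dom, Tape.cod]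

/-! ### Derived circuits: structure on monomials -/

/-- The identity circuit of a monomial. -/
def Circ.idW : Mono S → Circ S
  | [] => .idOne
  | A :: U => .idA A ⊠ Circ.idW U

/-- The symmetry `A ⊗ V → V ⊗ A`. -/
def Circ.symmA (A : S.Srt) : Mono S → Circ S
  | [] => .idA A
  | B :: V => (.symm A B ⊠ Circ.idW V) ⨟ (.idA B ⊠ Circ.symmA A V)

/-- The symmetry `U ⊗ V → V ⊗ U`. -/
def Circ.symmW : Mono S → Mono S → Circ S
  | [], V => Circ.idW V
  | A :: U, V => (.idA A ⊠ Circ.symmW U V) ⨟ (Circ.symmA A V ⊠ Circ.idW U)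

/-- The copier `U → U ⊗ U`. -/
def Circ.copyW : Mono S → Circ S
  | [] => .idOne
  | A :: U => (.copy A ⊠ Circ.copyW U) ⨟ (.idA A ⊠ Circ.symmW [A] U ⊠ Circ.idW U)

/-- The discharger `U → 1`. -/
def Circ.discardW : Mono S → Circ S
  | [] => .idOne
  | A :: U => .discard A ⊠ Circ.discardW U

/-- The cocopier `U ⊗ U → U`. -/
def Circ.cocopyW : Mono S → Circ S
  | [] => .idOne
  | A :: U => (.idA A ⊠ Circ.symmW U [A] ⊠ Circ.idW U) ⨟ (.cocopy A ⊠ Circ.cocopyW U)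

/-- The codischarger `1 → U`. -/
def Circ.codiscardW : Mono S → Circ S
  | [] => .idOne
  | A :: U => .codiscard A ⊠ Circ.codiscardW U

/-- The opposite `V → U` of a circuit `c : U → V`, obtained by bending wires:
`(id_V ⊗ (codischarger_U ; copier_U)) ; (id_V ⊗ c ⊗ id_U) ; ((cocopier_V ; discharger_V) ⊗ id_U)`. -/
def Circ.op (U V : Mono S) (c : Circ S) : Circ S :=
  (Circ.idW V ⊠ (Circ.codiscardW U ⨟ Circ.copyW U)) ⨟
    (Circ.idW V ⊠ c ⊠ Circ.idW U) ⨟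
    ((Circ.cocopyW V ⨟ Circ.discardW V) ⊠ Circ.idW U)

/-! ### Derived tapes: structure on polynomials -/

/-- The identity tape of a polynomial. -/
def Tape.idP : Poly S → Tape S
  | [] => .idZero
  | U :: P => .idU U ⊞ₜ Tape.idP P

/-- The symmetry `U ⊕ Q → Q ⊕ U`. -/
def Tape.symmU (U : Mono S) : Poly S → Tape S
  | [] => .idU U
  | V :: Q => (.symm U V ⊞ₜ Tape.idP Q) ⨟ₜ (.idU V ⊞ₜ Tape.symmU U Q)

/-- The symmetry `P ⊕ Q → Q ⊕ P`. -/
def Tape.symmP : Poly S → Poly S → Tape S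
  | [], Q => Tape.idP Q
  | U :: P, Q => (.idU U ⊞ₜ Tape.symmP P Q) ⨟ₜ (Tape.symmU U Q ⊞ₜ Tape.idP P)

/-- `P → P ⊕ P`. -/
def Tape.diagP : Poly S → Tape S
  | [] => .idZero
  | U :: P => (.diag U ⊞ₜ Tape.diagP P) ⨟ₜ (.idU U ⊞ₜ Tape.symmP [U] P ⊞ₜ Tape.idP P)

/-- `P → 0`. -/
def Tape.bangP : Poly S → Tape S
  | [] => .idZero
  | U :: P => .bang U ⊞ₜ Tape.bangP P

/-- `P ⊕ P → P`. -/
def Tape.codiagP : Poly S → Tape S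
  | [] => .idZero
  | U :: P => (.idU U ⊞ₜ Tape.symmP P [U] ⊞ₜ Tape.idP P) ⨟ₜ (.codiag U ⊞ₜ Tape.codiagP P)

/-- `0 → P`. -/
def Tape.cobangP : Poly S → Tape S
  | [] => .idZero
  | U :: P => .cobang U ⊞ₜ Tape.cobangP P

/-- The trace `P → Q` of `t : R ⊕ P → R ⊕ Q` along a polynomial `R`. -/
def Tape.trP : Poly S → Tape S → Tape S
  | [], t => t
  | U :: R, t => Tape.trP R (.tr U t)

/-- The Kleene star `t* : P → P` of `t : P → P`, as the trace of `(t ⊕ id) ; codiag ; diag`. -/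
def Tape.star (P : Poly S) (t : Tape S) : Tape S :=
  Tape.trP P ((t ⊞ₜ Tape.idP P) ⨟ₜ Tape.codiagP P ⨟ₜ Tape.diagP P)

/-- The left distributor `P ⊗ (Q ⊕ R) → (P ⊗ Q) ⊕ (P ⊗ R)`. -/
def Tape.dl : Poly S → Poly S → Poly S → Tape S
  | [], _, _ => .idZero
  | U :: P, Q, R =>
      (Tape.idP (Poly.mul [U] (Q ++ R)) ⊞ₜ Tape.dl P Q R) ⨟ₜ
        (Tape.idP (Poly.mul [U] Q) ⊞ₜ Tape.symmP (Poly.mul [U] R) (Poly.mul P Q) ⊞ₜ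
          Tape.idP (Poly.mul P R))

/-- The inverse of the left distributor. -/
def Tape.dlInv : Poly S → Poly S → Poly S → Tape S
  | [], _, _ => .idZero
  | U :: P, Q, R =>
      (Tape.idP (Poly.mul [U] Q) ⊞ₜ Tape.symmP (Poly.mul P Q) (Poly.mul [U] R) ⊞ₜ
          Tape.idP (Poly.mul P R)) ⨟ₜ
        (Tape.idP (Poly.mul [U] (Q ++ R)) ⊞ₜ Tape.dlInv P Q R)

/-- Left whiskering `U ⊗ t` by a monomial. -/
def Tape.lwU (U : Mono S) : Tape S → Tape S
  | .idU V => .idU (U ++ V)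
  | .idZero => .idZero
  | .circ c => .circ (Circ.idW U ⊠ c)
  | .symm V W => .symm (U ++ V) (U ++ W)
  | .seq t s => Tape.lwU U t ⨟ₜ Tape.lwU U s
  | .par t s => Tape.lwU U t ⊞ₜ Tape.lwU U s
  | .bang V => .bang (U ++ V)
  | .diag V => .diag (U ++ V)
  | .cobang V => .cobang (U ++ V)
  | .codiag V => .codiag (U ++ V)
  | .tr V t => .tr (U ++ V) (Tape.lwU U t)

/-- Right whiskering `t ⊗ U` by a monomial. -/
def Tape.rwU (U : Mono S) : Tape S → Tape S
  | .idU V => .idU (V ++ U)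
  | .idZero => .idZero
  | .circ c => .circ (c ⊠ Circ.idW U)
  | .symm V W => .symm (V ++ U) (W ++ U)
  | .seq t s => Tape.rwU U t ⨟ₜ Tape.rwU U s
  | .par t s => Tape.rwU U t ⊞ₜ Tape.rwU U s
  | .bang V => .bang (V ++ U)
  | .diag V => .diag (V ++ U)
  | .cobang V => .cobang (V ++ U)
  | .codiag V => .codiag (V ++ U)
  | .tr V t => .tr (V ++ U) (Tape.rwU U t)

/-- Left whiskering `P ⊗ t` by a polynomial. -/
def Tape.lwP : Poly S → Tape S → Tape S
  | [], _ => .idZero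
  | W :: P, t => Tape.lwU W t ⊞ₜ Tape.lwP P t

/-- Right whiskering `t ⊗ R` by a polynomial. -/
def Tape.rwP : Poly S → Tape S → Tape S
  | [], _ => .idZero
  | W :: R, t =>
      Tape.dl t.dom [W] R ⨟ₜ (Tape.rwU W t ⊞ₜ Tape.rwP R t) ⨟ₜ Tape.dlInv t.cod [W] R

/-- The product `t₁ ⊗ t₂ : P ⊗ R → Q ⊗ R'` of `t₁ : P → Q` and `t₂ : R → R'`. -/
def Tape.ten (t₁ t₂ : Tape S) : Tape S :=
  Tape.lwP t₁.dom t₂ ⨟ₜ Tape.rwP t₂.cod t₁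

/-! Typing of the derived circuits and tapes that occur in the theory of Peano. -/

theorem Circ.idW_typed : ∀ U : Mono S, (Circ.idW U).HasType U U
  | [] => .idOne
  | A :: U => .ten (.idA A) (Circ.idW_typed U)

theorem Circ.symmA_typed (A : S.Srt) : ∀ V : Mono S, (Circ.symmA A V).HasType (A :: V) (V ++ [A])
  | [] => .idA A
  | B :: V => .seq (V := [B] ++ (A :: V)) (.ten (.symm A B) (Circ.idW_typed V))
      (.ten (V₁ := [B]) (V₂ := V ++ [A]) (.idA B) (Circ.symmA_typed A V))

theorem Circ.symmW_typed : ∀ U V : Mono S, (Circ.symmW U V).HasType (U ++ V) (V ++ U)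
  | [], V => by simpa [Circ.symmW] using Circ.idW_typed V
  | A :: U, V => by
      have h := Circ.HasType.seq (.ten (.idA A) (Circ.symmW_typed U V))
        (by simpa using Circ.HasType.ten (Circ.symmA_typed A V) (Circ.idW_typed U))
      simpa [Circ.symmW] using h

theorem Circ.copyW_typed : ∀ U : Mono S, (Circ.copyW U).HasType U (U ++ U)
  | [] => .idOne
  | A :: U => by
      have h := Circ.HasType.ten (.ten (.idA A) (Circ.symmW_typed [A] U)) (Circ.idW_typed U)
      have h' := Circ.HasType.ten (.copy A) (Circ.copyW_typed U)
      simpa [Circ.copyW] using Circ.HasType.seq h' (by simpa using h)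

theorem Circ.cocopyW_typed : ∀ U : Mono S, (Circ.cocopyW U).HasType (U ++ U) U
  | [] => .idOne
  | A :: U => by
      have h := Circ.HasType.ten (.ten (.idA A) (Circ.symmW_typed U [A])) (Circ.idW_typed U)
      have h' := Circ.HasType.ten (.cocopy A) (Circ.cocopyW_typed U)
      have := Circ.HasType.seq (by simpa using h) h'
      simpa [Circ.cocopyW] using this

theorem Circ.discardW_typed : ∀ U : Mono S, (Circ.discardW U).HasType U []
  | [] => .idOne
  | A :: U => .ten (.discard A) (Circ.discardW_typed U)

theorem Circ.codiscardW_typed : ∀ U : Mono S, (Circ.codiscardW U).HasType [] U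
  | [] => .idOne
  | A :: U => .ten (.codiscard A) (Circ.codiscardW_typed U)

theorem Circ.op_typed {U V : Mono S} {c : Circ S} (h : c.HasType U V) :
    (Circ.op U V c).HasType V U := by
  have h₁ := Circ.HasType.ten (Circ.idW_typed V)
    (.seq (Circ.codiscardW_typed U) (Circ.copyW_typed U))
  have h₂ := Circ.HasType.ten (.ten (Circ.idW_typed V) h) (Circ.idW_typed U)
  have h₃ := Circ.HasType.ten (.seq (Circ.cocopyW_typed V) (Circ.discardW_typed V))
    (Circ.idW_typed U)
  exact .seq (.seq (by simpa using h₁) (by simpa using h₂)) (by simpa using h₃)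

theorem Tape.idP_typed : ∀ P : Poly S, (Tape.idP P).HasType P P
  | [] => .idZero
  | U :: P => .par (.idU U) (Tape.idP_typed P)

theorem Tape.symmU_typed (U : Mono S) : ∀ Q : Poly S, (Tape.symmU U Q).HasType (U :: Q) (Q ++ [U])
  | [] => .idU U
  | V :: Q => .seq (Q := [V] ++ (U :: Q)) (.par (.symm U V) (Tape.idP_typed Q))
      (.par (Q₁ := [V]) (Q₂ := Q ++ [U]) (.idU V) (Tape.symmU_typed U Q))

theorem Tape.symmP_typed : ∀ P Q : Poly S, (Tape.symmP P Q).HasType (P ++ Q) (Q ++ P)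
  | [], Q => by simpa [Tape.symmP] using Tape.idP_typed Q
  | U :: P, Q => by
      have h := Tape.HasType.seq (.par (.idU U) (Tape.symmP_typed P Q))
        (by simpa using Tape.HasType.par (Tape.symmU_typed U Q) (Tape.idP_typed P))
      simpa [Tape.symmP] using h

theorem Tape.diagP_typed : ∀ P : Poly S, (Tape.diagP P).HasType P (P ++ P)
  | [] => .idZero
  | U :: P => by
      have h := Tape.HasType.par (.par (.idU U) (Tape.symmP_typed [U] P)) (Tape.idP_typed P)
      have h' := Tape.HasType.par (.diag U) (Tape.diagP_typed P)
      simpa [Tape.diagP] using Tape.HasType.seq h' (by simpa using h)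

theorem Tape.codiagP_typed : ∀ P : Poly S, (Tape.codiagP P).HasType (P ++ P) P
  | [] => .idZero
  | U :: P => by
      have h := Tape.HasType.par (.par (.idU U) (Tape.symmP_typed P [U])) (Tape.idP_typed P)
      have h' := Tape.HasType.par (.codiag U) (Tape.codiagP_typed P)
      have := Tape.HasType.seq (by simpa using h) h'
      simpa [Tape.codiagP] using this

theorem Tape.trP_typed : ∀ (R : Poly S) {P Q : Poly S} {t : Tape S},
    t.HasType (R ++ P) (R ++ Q) → (Tape.trP R t).HasType P Q
  | [], _, _, _, h => h
  | _ :: R, _, _, _, h => Tape.trP_typed R (.tr h)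

theorem Tape.star_typed {P : Poly S} {t : Tape S} (h : t.HasType P P) :
    (Tape.star P t).HasType P P :=
  Tape.trP_typed P (.seq (.seq (.par h (Tape.idP_typed P)) (Tape.codiagP_typed P))
    (Tape.diagP_typed P))

/-! ### The axioms of Kleene-Cartesian tapes -/

/-- Equations between circuits: symmetric monoidal categories, (co)commutative (co)monoids,
special Frobenius algebras. -/
inductive Circ.AxEq : Circ S → Circ S → Prop where
  | assoc (f g h : Circ S) : AxEq (f ⨟ g ⨟ h) (f ⨟ (g ⨟ h))
  | id_seq (U : Mono S) (f : Circ S) : AxEq (Circ.idW U ⨟ f) f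
  | seq_id (f : Circ S) (V : Mono S) : AxEq (f ⨟ Circ.idW V) f
  | interchange (f₁ f₂ g₁ g₂ : Circ S) :
      AxEq ((f₁ ⊠ f₂) ⨟ (g₁ ⊠ g₂)) ((f₁ ⨟ g₁) ⊠ (f₂ ⨟ g₂))
  | one_ten (f : Circ S) : AxEq (.idOne ⊠ f) f
  | ten_one (f : Circ S) : AxEq (f ⊠ .idOne) f
  | ten_assoc (f g h : Circ S) : AxEq (f ⊠ g ⊠ h) (f ⊠ (g ⊠ h))
  | symm_inv (A B : S.Srt) : AxEq (.symm A B ⨟ .symm B A) (.idA A ⊠ .idA B)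
  | symm_nat (f : Circ S) (U V W : Mono S) : f.HasType U V →
      AxEq ((f ⊠ Circ.idW W) ⨟ Circ.symmW V W) (Circ.symmW U W ⨟ (Circ.idW W ⊠ f))
  | copy_assoc (A : S.Srt) :
      AxEq (.copy A ⨟ (.idA A ⊠ .copy A)) (.copy A ⨟ (.copy A ⊠ .idA A))
  | copy_unit (A : S.Srt) : AxEq (.copy A ⨟ (.discard A ⊠ .idA A)) (.idA A)
  | copy_comm (A : S.Srt) : AxEq (.copy A ⨟ .symm A A) (.copy A)
  | cocopy_assoc (A : S.Srt) :
      AxEq ((.idA A ⊠ .cocopy A) ⨟ .cocopy A) ((.cocopy A ⊠ .idA A) ⨟ .cocopy A)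
  | cocopy_unit (A : S.Srt) : AxEq ((.codiscard A ⊠ .idA A) ⨟ .cocopy A) (.idA A)
  | cocopy_comm (A : S.Srt) : AxEq (.symm A A ⨟ .cocopy A) (.cocopy A)
  | frobenius (A : S.Srt) :
      AxEq ((.idA A ⊠ .copy A) ⨟ (.cocopy A ⊠ .idA A)) (.cocopy A ⨟ .copy A)
  | special (A : S.Srt) : AxEq (.idA A) (.copy A ⨟ .cocopy A)

/-- Inequations between circuits: lax naturality and adjointness. -/
inductive Circ.AxLe : Circ S → Circ S → Prop where
  | copy_nat (s : S.Op) :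
      AxLe (.gen s ⨟ Circ.copyW (S.coar s)) (Circ.copyW (S.ar s) ⨟ (.gen s ⊠ .gen s))
  | discard_nat (s : S.Op) :
      AxLe (.gen s ⨟ Circ.discardW (S.coar s)) (Circ.discardW (S.ar s))
  | copy_cocopy (A : S.Srt) : AxLe (.idA A) (.copy A ⨟ .cocopy A)
  | cocopy_copy (A : S.Srt) : AxLe (.cocopy A ⨟ .copy A) (.idA A ⊠ .idA A)
  | discard_codiscard (A : S.Srt) : AxLe (.idA A) (.discard A ⨟ .codiscard A)
  | codiscard_discard (A : S.Srt) : AxLe (.codiscard A ⨟ .discard A) .idOne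

/-- Equations between tapes. -/
inductive Tape.AxEq : Tape S → Tape S → Prop where
  | of_circ {c d : Circ S} : Circ.AxEq c d → AxEq (.circ c) (.circ d)
  | circ_id (U : Mono S) : AxEq (.circ (Circ.idW U)) (.idU U)
  | circ_seq (c d : Circ S) : AxEq (.circ (c ⨟ d)) (.circ c ⨟ₜ .circ d)
  -- symmetric monoidal structure of `⊕`
  | assoc (f g h : Tape S) : AxEq (f ⨟ₜ g ⨟ₜ h) (f ⨟ₜ (g ⨟ₜ h))
  | id_seq (P : Poly S) (f : Tape S) : AxEq (Tape.idP P ⨟ₜ f) f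
  | seq_id (f : Tape S) (Q : Poly S) : AxEq (f ⨟ₜ Tape.idP Q) f
  | interchange (f₁ f₂ g₁ g₂ : Tape S) :
      AxEq ((f₁ ⊞ₜ f₂) ⨟ₜ (g₁ ⊞ₜ g₂)) ((f₁ ⨟ₜ g₁) ⊞ₜ (f₂ ⨟ₜ g₂))
  | zero_par (f : Tape S) : AxEq (.idZero ⊞ₜ f) f
  | par_zero (f : Tape S) : AxEq (f ⊞ₜ .idZero) f
  | par_assoc (f g h : Tape S) : AxEq (f ⊞ₜ g ⊞ₜ h) (f ⊞ₜ (g ⊞ₜ h))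
  | symm_inv (U V : Mono S) : AxEq (.symm U V ⨟ₜ .symm V U) (.idU U ⊞ₜ .idU V)
  | symm_nat (f : Tape S) (P Q R : Poly S) : f.HasType P Q →
      AxEq ((f ⊞ₜ Tape.idP R) ⨟ₜ Tape.symmP Q R) (Tape.symmP P R ⨟ₜ (Tape.idP R ⊞ₜ f))
  -- traces
  | tightening (U : Mono S) (u t v : Tape S) :
      AxEq (.tr U ((.idU U ⊞ₜ u) ⨟ₜ t ⨟ₜ (.idU U ⊞ₜ v))) (u ⨟ₜ .tr U t ⨟ₜ v)
  | strength (U : Mono S) (t s : Tape S) : AxEq (.tr U (t ⊞ₜ s)) (.tr U t ⊞ₜ s)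
  | joining (P R : Poly S) (t : Tape S) :
      AxEq (Tape.trP R (Tape.trP P t)) (Tape.trP (P ++ R) t)
  | vanishing (t : Tape S) : AxEq (Tape.trP [] t) t
  | sliding (U V : Mono S) (u t : Tape S) (P Q : Poly S) : u.HasType [U] [V] →
      AxEq (.tr V (t ⨟ₜ (u ⊞ₜ Tape.idP Q))) (.tr U ((u ⊞ₜ Tape.idP P) ⨟ₜ t))
  | yanking (U : Mono S) : AxEq (.tr U (.symm U U)) (.idU U)
  -- (co)commutative (co)monoids, bialgebra laws and naturality
  | diag_assoc (U : Mono S) :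
      AxEq (.diag U ⨟ₜ (.idU U ⊞ₜ .diag U)) (.diag U ⨟ₜ (.diag U ⊞ₜ .idU U))
  | diag_unit (U : Mono S) : AxEq (.diag U ⨟ₜ (.bang U ⊞ₜ .idU U)) (.idU U)
  | diag_comm (U : Mono S) : AxEq (.diag U ⨟ₜ .symm U U) (.diag U)
  | codiag_assoc (U : Mono S) :
      AxEq ((.idU U ⊞ₜ .codiag U) ⨟ₜ .codiag U) ((.codiag U ⊞ₜ .idU U) ⨟ₜ .codiag U)
  | codiag_unit (U : Mono S) : AxEq ((.cobang U ⊞ₜ .idU U) ⨟ₜ .codiag U) (.idU U)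
  | codiag_comm (U : Mono S) : AxEq (.symm U U ⨟ₜ .codiag U) (.codiag U)
  | codiag_diag (U : Mono S) :
      AxEq (.codiag U ⨟ₜ .diag U) (Tape.diagP [U, U] ⨟ₜ (.codiag U ⊞ₜ .codiag U))
  | cobang_bang (U : Mono S) : AxEq (.cobang U ⨟ₜ .bang U) .idZero
  | cobang_diag (U : Mono S) : AxEq (.cobang U ⨟ₜ .diag U) (Tape.cobangP [U, U])
  | codiag_bang (U : Mono S) : AxEq (.codiag U ⨟ₜ .bang U) (Tape.bangP [U, U])
  | bang_nat (c : Circ S) (U V : Mono S) : AxEq (.circ c ⨟ₜ .bang V) (.bang U)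
  | diag_nat (c : Circ S) (U V : Mono S) :
      AxEq (.circ c ⨟ₜ .diag V) (.diag U ⨟ₜ (.circ c ⊞ₜ .circ c))
  | cobang_nat (c : Circ S) (U V : Mono S) : AxEq (.cobang U ⨟ₜ .circ c) (.cobang V)
  | codiag_nat (c : Circ S) (U V : Mono S) :
      AxEq (.codiag U ⨟ₜ .circ c) ((.circ c ⊞ₜ .circ c) ⨟ₜ .codiag V)
  -- the trace of `codiag ; diag`
  | trace_id (U : Mono S) : AxEq (.tr U (.codiag U ⨟ₜ .diag U)) (.idU U)

/-- Inequations between tapes. -/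
inductive Tape.AxLe : Tape S → Tape S → Prop where
  | of_circ {c d : Circ S} : Circ.AxLe c d → AxLe (.circ c) (.circ d)
  | diag_codiag (U : Mono S) : AxLe (.diag U ⨟ₜ .codiag U) (.idU U)
  | codiag_diag (U : Mono S) : AxLe (.idU U ⊞ₜ .idU U) (.codiag U ⨟ₜ .diag U)
  | bang_cobang (U : Mono S) : AxLe (.bang U ⨟ₜ .cobang U) (.idU U)
  | cobang_bang (U : Mono S) : AxLe .idZero (.cobang U ⨟ₜ .bang U)

/-- The set `𝕂ℂ` of axioms. Only those instances in which both sides have the same type are used,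
see `Tape.Le.ax`. -/
def Tape.KC (t s : Tape S) : Prop :=
  Tape.AxEq t s ∨ Tape.AxEq s t ∨ Tape.AxLe t s

/-- The precongruence on well-typed tapes generated by a set `I` of pairs of tapes and closed under
posetal uniformity of traces; `Tape.Le I P Q t s` says that `t ≤ s` as tapes `P → Q`. -/
inductive Tape.Le (I : Tape S → Tape S → Prop) :
    Poly S → Poly S → Tape S → Tape S → Prop where
  | ax {t s : Tape S} {P Q : Poly S} :
      I t s → t.HasType P Q → s.HasType P Q → Le I P Q t s
  | refl {t : Tape S} {P Q : Poly S} : t.HasType P Q → Le I P Q t t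
  | trans {t₁ t₂ t₃ : Tape S} {P Q : Poly S} :
      Le I P Q t₁ t₂ → Le I P Q t₂ t₃ → Le I P Q t₁ t₃
  | seq {t₁ t₂ s₁ s₂ : Tape S} {P Q R : Poly S} :
      Le I P Q t₁ t₂ → Le I Q R s₁ s₂ → Le I P R (t₁ ⨟ₜ s₁) (t₂ ⨟ₜ s₂)
  | par {t₁ t₂ s₁ s₂ : Tape S} {P Q P' Q' : Poly S} :
      Le I P Q t₁ t₂ → Le I P' Q' s₁ s₂ → Le I (P ++ P') (Q ++ Q') (t₁ ⊞ₜ s₁) (t₂ ⊞ₜ s₂)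
  | ten {t₁ t₂ s₁ s₂ : Tape S} {P Q P' Q' : Poly S} :
      Le I P Q t₁ t₂ → Le I P' Q' s₁ s₂ →
      Le I (Poly.mul P P') (Poly.mul Q Q') (Tape.ten t₁ s₁) (Tape.ten t₂ s₂)
  | unif_r {t₁ t₂ s₁ s₂ : Tape S} {R₁ R₂ P Q : Poly S} :
      t₁.HasType (R₁ ++ P) (R₁ ++ Q) → t₂.HasType (R₂ ++ P) (R₂ ++ Q) →
      Le I R₁ R₂ s₂ s₁ →
      Le I (R₁ ++ P) (R₂ ++ Q) (t₁ ⨟ₜ (s₁ ⊞ₜ Tape.idP Q)) ((s₂ ⊞ₜ Tape.idP P) ⨟ₜ t₂) →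
      Le I P Q (Tape.trP R₁ t₁) (Tape.trP R₂ t₂)
  | unif_l {t₁ t₂ s₁ s₂ : Tape S} {R₁ R₂ P Q : Poly S} :
      t₁.HasType (R₁ ++ P) (R₁ ++ Q) → t₂.HasType (R₂ ++ P) (R₂ ++ Q) →
      Le I R₂ R₁ s₂ s₁ →
      Le I (R₂ ++ P) (R₁ ++ Q) ((s₁ ⊞ₜ Tape.idP P) ⨟ₜ t₁) (t₂ ⨟ₜ (s₂ ⊞ₜ Tape.idP Q)) →
      Le I P Q (Tape.trP R₁ t₁) (Tape.trP R₂ t₂)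

/-- A Kleene-Cartesian theory over the signature `S`: a set of pairs of tapes with the same source
and target, each pair `(t, s)` being read as `t ≤ s`. -/
structure Theory (S : MonSig) where
  ax : Tape S → Tape S → Prop
  typed : ∀ t s, ax t s → ∃ P Q, t.HasType P Q ∧ s.HasType P Q

/-- The order on tapes induced by a theory (on top of the axioms `𝕂ℂ`). -/
def Theory.Le (T : Theory S) : Poly S → Poly S → Tape S → Tape S → Prop :=
  Tape.Le (fun t s => Tape.KC t s ∨ T.ax t s)

/-! ### Interpretations in `Rel` -/

/-- The product `α A₁ × ⋯ × α Aₙ` of a word `A₁ ⋯ Aₙ`. -/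
def Word {Srt : Type} (α : Srt → Type u) : List Srt → Type u
  | [] => PUnit
  | A :: U => α A × Word α U

def Word.toList {Srt : Type} {α : Srt → Type u} :
    {U : List Srt} → Word α U → List (Σ A, α A)
  | [], _ => []
  | A :: _, w => ⟨A, w.1⟩ :: Word.toList w.2

def Word.map {Srt : Type} {α : Srt → Type u} {β : Srt → Type v} (e : ∀ A, α A → β A) :
    {U : List Srt} → Word α U → Word β U
  | [], _ => PUnit.unit
  | A :: _, w => (e A w.1, Word.map e w.2)

/-- An interpretation of a monoidal signature in `Rel`: a set for every sort, and a relation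
between the products of the arity and of the coarity for every symbol. -/
structure Interp (S : MonSig) where
  carrier : S.Srt → Type u
  rel : (s : S.Op) → Word carrier (S.ar s) → Word carrier (S.coar s) → Prop

/-- Isomorphism of interpretations: bijections between the carriers that preserve and reflect the
relations. -/
structure Interp.Iso (I : Interp.{u} S) (J : Interp.{v} S) where
  equiv : ∀ A, I.carrier A ≃ J.carrier A
  rel_iff : ∀ (s : S.Op) (x : Word I.carrier (S.ar s)) (y : Word I.carrier (S.coar s)),
    I.rel s x y ↔ J.rel s (x.map fun A => equiv A) (y.map fun A => equiv A)

/-! ### Semantics of circuits and tapes in `Rel`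

To have `⊗` and `⊕` strictly associative and unital, an element of the product `⟦U⟧` is written as
the list of its sorted components, and an element of the sum `⟦U₀ ⊕ ⋯ ⊕ Uₙ₋₁⟧` is a pair `(i, x)`
with `i < n` and `x ∈ ⟦Uᵢ⟧`. Thus `⟦P⟧ ⊕ ⟦Q⟧` is a disjoint union in which the tags of the second
summand are shifted by the length of `P`. -/

abbrev Interp.Elt (I : Interp.{u} S) : Type u := List (Σ A, I.carrier A)

/-- `x ∈ ⟦U⟧`. -/
def Interp.Mem (I : Interp.{u} S) (U : Mono S) (x : I.Elt) : Prop :=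
  ∃ w : Word I.carrier U, x = w.toList

/-- The relation `⟦c⟧ ⊆ ⟦U⟧ × ⟦V⟧` denoted by a circuit `c : U → V`. -/
def Circ.sem (I : Interp.{u} S) : Circ S → I.Elt → I.Elt → Prop
  | .idA A, x, y => I.Mem [A] x ∧ y = x
  | .idOne, x, y => x = [] ∧ y = []
  | .gen s, x, y => ∃ a b, x = Word.toList a ∧ y = Word.toList b ∧ I.rel s a b
  | .symm A B, x, y =>
      ∃ (a : I.carrier A) (b : I.carrier B), x = [⟨A, a⟩, ⟨B, b⟩] ∧ y = [⟨B, b⟩, ⟨A, a⟩]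
  | .seq c d, x, y => ∃ z, Circ.sem I c x z ∧ Circ.sem I d z y
  | .ten c d, x, y => ∃ x₁ x₂ y₁ y₂, x = x₁ ++ x₂ ∧ y = y₁ ++ y₂ ∧
      Circ.sem I c x₁ y₁ ∧ Circ.sem I d x₂ y₂
  | .discard A, x, y => ∃ a : I.carrier A, x = [⟨A, a⟩] ∧ y = []
  | .copy A, x, y => ∃ a : I.carrier A, x = [⟨A, a⟩] ∧ y = [⟨A, a⟩, ⟨A, a⟩]
  | .codiscard A, x, y => ∃ a : I.carrier A, x = [] ∧ y = [⟨A, a⟩]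
  | .cocopy A, x, y => ∃ a : I.carrier A, x = [⟨A, a⟩, ⟨A, a⟩] ∧ y = [⟨A, a⟩]

/-- The relation `⟦t⟧ ⊆ ⟦P⟧ × ⟦Q⟧` denoted by a tape `t : P → Q`. The clause for `tr U t`, with
`t : U ⊕ P → U ⊕ Q`, is `f_PQ ∪ (f_PU ; (f_UU)* ; f_UQ)` where `f = ⟦t⟧`. -/
def Tape.sem (I : Interp.{u} S) : Tape S → ℕ × I.Elt → ℕ × I.Elt → Prop
  | .idU U, x, y => x.1 = 0 ∧ I.Mem U x.2 ∧ y = x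
  | .idZero, _, _ => False
  | .circ c, x, y => x.1 = 0 ∧ y.1 = 0 ∧ Circ.sem I c x.2 y.2
  | .symm U V, x, y =>
      (x.1 = 0 ∧ I.Mem U x.2 ∧ y = (1, x.2)) ∨ (x.1 = 1 ∧ I.Mem V x.2 ∧ y = (0, x.2))
  | .seq t s, x, y => ∃ z, Tape.sem I t x z ∧ Tape.sem I s z y
  | .par t s, x, y => Tape.sem I t x y ∨
      ∃ i j a b, x = (t.dom.length + i, a) ∧ y = (t.cod.length + j, b) ∧
        Tape.sem I s (i, a) (j, b)
  | .bang _, _, _ => False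
  | .diag U, x, y => x.1 = 0 ∧ I.Mem U x.2 ∧ (y = (0, x.2) ∨ y = (1, x.2))
  | .cobang _, _, _ => False
  | .codiag U, x, y => (x.1 = 0 ∨ x.1 = 1) ∧ I.Mem U x.2 ∧ y = (0, x.2)
  | .tr _ t, x, y => Tape.sem I t (x.1 + 1, x.2) (y.1 + 1, y.2) ∨
      ∃ a b, Tape.sem I t (x.1 + 1, x.2) (0, a) ∧
        Relation.ReflTransGen (fun c d => Tape.sem I t (0, c) (0, d)) a b ∧
        Tape.sem I t (0, b) (y.1 + 1, y.2)

/-- An interpretation in `Rel` is a model of a theory when its semantics preserves the order on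
tapes induced by the theory. -/
def Interp.IsModel (I : Interp.{u} S) (T : Theory S) : Prop :=
  ∀ P Q t s, T.Le P Q t s → ∀ x y, Tape.sem I t x y → Tape.sem I s x y

/-! ### The Kleene-Cartesian theory of Peano -/

inductive PeanoOp : Type where
  | zero
  | succ

/-- One sort `A`, a constant `zero : 1 → A` and a unary symbol `succ : A → A`. -/
def peanoSig : MonSig where
  Srt := Unit
  Op := PeanoOp
  ar := fun s => match s with
    | .zero => []
    | .succ => [()]
  coar := fun _ => [()]

namespace Peano

/-- The unique sort, as a monomial. -/
def A : Mono peanoSig := [()]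

def zeroC : Circ peanoSig := .gen PeanoOp.zero

def succC : Circ peanoSig := .gen PeanoOp.succ

/-- `[s, 0] = (s ⊕ 0) ; codiag : A ⊕ 1 → A`. -/
def copair : Tape peanoSig := (.circ succC ⊞ₜ .circ zeroC) ⨟ₜ .codiag A

/-- The opposite `[s, 0]° = diag ; (s° ⊕ 0°) : A → A ⊕ 1`. -/
def copairOp : Tape peanoSig :=
  .diag A ⨟ₜ (.circ (Circ.op A A succC) ⊞ₜ .circ (Circ.op [] A zeroC))

/-- The axioms: `[s, 0]° ; [s, 0] = id_A`, `[s, 0] ; [s, 0]° = id_{A ⊕ 1}`, and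
`codischarger_A ≤ 0 ; s*`. -/
inductive Ax : Tape peanoSig → Tape peanoSig → Prop where
  | iso₁_le : Ax (copairOp ⨟ₜ copair) (.idU A)
  | iso₁_ge : Ax (.idU A) (copairOp ⨟ₜ copair)
  | iso₂_le : Ax (copair ⨟ₜ copairOp) (.idU A ⊞ₜ .idU [])
  | iso₂_ge : Ax (.idU A ⊞ₜ .idU []) (copair ⨟ₜ copairOp)
  | ind : Ax (.circ (.codiscard ())) (.circ zeroC ⨟ₜ Tape.star [A] (.circ succC))

end Peano

/-- The Kleene-Cartesian theory of Peano. -/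
def peanoTheory : Theory peanoSig where
  ax := Peano.Ax
  typed := by
    have hs : Peano.succC.HasType Peano.A Peano.A := Circ.HasType.gen (S := peanoSig) PeanoOp.succ
    have hz : Peano.zeroC.HasType [] Peano.A := Circ.HasType.gen (S := peanoSig) PeanoOp.zero
    have hc : Peano.copair.HasType [Peano.A, []] [Peano.A] :=
      .seq (.par (.circ hs) (.circ hz)) (.codiag _)
    have ho : Peano.copairOp.HasType [Peano.A] [Peano.A, []] :=
      .seq (.diag _) (.par (.circ (Circ.op_typed hs)) (.circ (Circ.op_typed hz)))
    have hi : (Tape.idU Peano.A ⊞ₜ Tape.idU []).HasType [Peano.A, []] [Peano.A, []] :=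
      .par (.idU _) (.idU _)
    intro t s h
    cases h with
    | iso₁_le => exact ⟨_, _, .seq ho hc, .idU _⟩
    | iso₁_ge => exact ⟨_, _, .idU _, .seq ho hc⟩
    | iso₂_le => exact ⟨_, _, .seq hc ho, hi⟩
    | iso₂_ge => exact ⟨_, _, hi, .seq hc ho⟩
    | ind => exact ⟨_, _, .circ (.codiscard _), .seq (.circ hz) (Tape.star_typed (.circ hs))⟩

/-- The interpretation `(ℕ, 0, succ)`. -/
def natInterp : Interp.{0} peanoSig where
  carrier := fun _ => ℕ
  rel := fun s => match s with
    | .zero => fun (_ : Word (fun _ => ℕ) []) (y : Word (fun _ => ℕ) [()]) => y.1 = 0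
    | .succ => fun (x y : Word (fun _ => ℕ) [()]) => y.1 = Nat.succ x.1

end KleeneCartesian

/-! The semantics in `Rel` is sound, hence interpretations satisfying the axioms are models; a model
of the theory of Peano is isomorphic to the natural numbers. -/

namespace KleeneCartesian

variable {S : MonSig}

/-! ### Semantics of circuits -/

/-! Soundness. The order induced by a theory is generated inductively, so an interpretation is a
model as soon as it validates the theory's own axioms, provided every Kleene-Cartesian axiom and
every closure rule holds in `Rel` (`Interp.isModel_of_ax`). Terms are raw and their semantics is
untyped, hence typing has to be recovered semantically: a list of sorted components determines its
word of sorts, so a list over `U ++ V` splits in only one way.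

Three points carry this half. Traces are described by `Run`, a path through the traced summands;
uniformity then becomes a simulation argument on paths (`Run.uniformity_right`,
`Run.uniformity_left`), and sliding follows from it. Whiskering by a monomial denotes the product
with an identity relation (`Tape.sem_lwU`, `Tape.sem_rwU`), which makes `Tape.ten` monotone.
Structural tapes only relabel summands (`Tape.Moves`), so their equations are arithmetic on indices.

Categoricity. In a model, the inclusions between `[s, 0]` composed with its converse and the
identities say that `[s, 0]` is a bijection from `X ⊕ 1` to `X`: zero is a single element, successor
is an injective function, and zero is not a successor. The star of a circuit denotes
reflexive-transitive closure (`Tape.sem_star_circ`), so the last axiom says that every element is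
reached from zero by successors. These are Dedekind's conditions, and `n ↦ σ^[n] z` is the required
bijection. -/

theorem Word.map_fst_toList {Srt : Type} {α : Srt → Type u} :
    ∀ {U : List Srt} (w : Word α U), w.toList.map Sigma.fst = U
  | [], _ => rfl
  | A :: U, w => by simp [Word.toList, Word.map_fst_toList (U := U) w.2]

/-- The elements of `⟦U⟧` are the lists whose word of sorts is `U`. -/
theorem Interp.mem_iff (I : Interp.{u} S) {U : Mono S} {x : I.Elt} :
    I.Mem U x ↔ x.map Sigma.fst = U := by
  constructor
  · rintro ⟨w, rfl⟩
    exact w.map_fst_toList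
  · rintro rfl
    induction x with
    | nil => exact ⟨PUnit.unit, rfl⟩
    | cons a x ih =>
      obtain ⟨w, hw⟩ := ih
      exact ⟨(a.2, w), congrArg (List.cons a) hw⟩

theorem map_fst_eq_singleton (I : Interp.{u} S) {A : S.Srt} {x : I.Elt} :
    x.map Sigma.fst = [A] ↔ ∃ a : I.carrier A, x = [⟨A, a⟩] := by
  constructor
  · intro h
    obtain ⟨⟨B, b⟩, rfl, rfl⟩ := List.map_eq_singleton_iff.1 h
    exact ⟨b, rfl⟩
  · rintro ⟨a, rfl⟩
    rfl

theorem map_fst_eq_append (I : Interp.{u} S) {U V : Mono S} {x : I.Elt} :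
    x.map Sigma.fst = U ++ V ↔
      ∃ u v : I.Elt, u.map Sigma.fst = U ∧ v.map Sigma.fst = V ∧ x = u ++ v := by
  rw [List.map_eq_append_iff]
  constructor
  · rintro ⟨u, v, rfl, h, h'⟩
    exact ⟨u, v, h, h', rfl⟩
  · rintro ⟨u, v, h, h', rfl⟩
    exact ⟨u, v, rfl, h, h'⟩

/-- The sorts of a prefix fix its length, hence the place of the cut. Every comparison of two
decompositions of an intermediate state rests on this lemma or on its variant for suffixes. -/
theorem append_inj_of_map_fst (I : Interp.{u} S) {u u' v v' : I.Elt} {U : Mono S}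
    (h : u ++ v = u' ++ v') (hu : u.map Sigma.fst = U) (hu' : u'.map Sigma.fst = U) :
    u = u' ∧ v = v' :=
  List.append_inj h (by rw [← List.length_map Sigma.fst, hu, ← hu', List.length_map])

theorem append_inj_of_map_fst' (I : Interp.{u} S) {u u' v v' : I.Elt} {V : Mono S}
    (h : u ++ v = u' ++ v') (hv : v.map Sigma.fst = V) (hv' : v'.map Sigma.fst = V) :
    u = u' ∧ v = v' :=
  List.append_inj' h (by rw [← List.length_map Sigma.fst, hv, ← hv', List.length_map])

theorem Circ.HasType.sem_typed (I : Interp.{u} S) {c : Circ S} {U V : Mono S}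
    (h : c.HasType U V) :
    ∀ {x y : I.Elt}, c.sem I x y → x.map Sigma.fst = U ∧ y.map Sigma.fst = V := by
  induction h with
  | idA A =>
    rintro x y ⟨hx, rfl⟩
    exact ⟨I.mem_iff.1 hx, I.mem_iff.1 hx⟩
  | idOne => rintro x y ⟨rfl, rfl⟩; exact ⟨rfl, rfl⟩
  | gen s =>
    rintro x y ⟨a, b, rfl, rfl, -⟩
    exact ⟨a.map_fst_toList, b.map_fst_toList⟩
  | symm A B => rintro x y ⟨a, b, rfl, rfl⟩; exact ⟨rfl, rfl⟩
  | seq _ _ ih₁ ih₂ =>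
    rintro x y ⟨z, h₁, h₂⟩
    exact ⟨(ih₁ h₁).1, (ih₂ h₂).2⟩
  | ten _ _ ih₁ ih₂ =>
    rintro x y ⟨x₁, x₂, y₁, y₂, rfl, rfl, h₁, h₂⟩
    simp [ih₁ h₁, ih₂ h₂]
  | discard A => rintro x y ⟨a, rfl, rfl⟩; exact ⟨rfl, rfl⟩
  | copy A => rintro x y ⟨a, rfl, rfl⟩; exact ⟨rfl, rfl⟩
  | codiscard A => rintro x y ⟨a, rfl, rfl⟩; exact ⟨rfl, rfl⟩
  | cocopy A => rintro x y ⟨a, rfl, rfl⟩; exact ⟨rfl, rfl⟩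

theorem Circ.sem_seq (I : Interp.{u} S) {c d : Circ S} {x y : I.Elt} :
    (c ⨟ d).sem I x y ↔ ∃ z, c.sem I x z ∧ d.sem I z y := Iff.rfl

theorem Circ.sem_ten (I : Interp.{u} S) {c d : Circ S} {x y : I.Elt} :
    (c ⊠ d).sem I x y ↔ ∃ x₁ x₂ y₁ y₂, x = x₁ ++ x₂ ∧ y = y₁ ++ y₂ ∧ c.sem I x₁ y₁ ∧
      d.sem I x₂ y₂ := Iff.rfl

theorem Circ.sem_idA (I : Interp.{u} S) {A : S.Srt} {x y : I.Elt} :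
    (Circ.idA A).sem I x y ↔ ∃ a : I.carrier A, x = [⟨A, a⟩] ∧ y = [⟨A, a⟩] := by
  rw [Circ.sem, I.mem_iff, map_fst_eq_singleton]
  constructor
  · rintro ⟨⟨a, rfl⟩, rfl⟩
    exact ⟨a, rfl, rfl⟩
  · rintro ⟨a, rfl, rfl⟩
    exact ⟨⟨a, rfl⟩, rfl⟩

theorem map_fst_eq_cons (I : Interp.{u} S) {A : S.Srt} {U : Mono S} {x : I.Elt} :
    x.map Sigma.fst = A :: U ↔
      ∃ (a : I.carrier A) (u : I.Elt), u.map Sigma.fst = U ∧ x = ⟨A, a⟩ :: u := by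
  rw [show A :: U = [A] ++ U from rfl, map_fst_eq_append]
  constructor
  · rintro ⟨u, v, hu, hv, rfl⟩
    obtain ⟨a, rfl⟩ := (map_fst_eq_singleton I).1 hu
    exact ⟨a, v, hv, rfl⟩
  · rintro ⟨a, u, hu, rfl⟩
    exact ⟨[⟨A, a⟩], u, rfl, hu, rfl⟩

theorem Circ.sem_idW (I : Interp.{u} S) {U : Mono S} :
    ∀ {x y : I.Elt}, (Circ.idW U).sem I x y ↔ x.map Sigma.fst = U ∧ y = x := by
  induction U with
  | nil => intro x y; simp +contextual [Circ.idW, Circ.sem]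
  | cons A U ih =>
    intro x y
    simp only [Circ.idW, Circ.sem, ih, map_fst_eq_cons, I.mem_iff]
    constructor
    · rintro ⟨x₁, x₂, y₁, y₂, rfl, rfl, ⟨⟨a, u, hu, rfl⟩, rfl⟩, h₂, rfl⟩
      obtain rfl := List.map_eq_nil_iff.1 hu
      exact ⟨⟨a, _, h₂, rfl⟩, rfl⟩
    · rintro ⟨⟨a, u, hu, rfl⟩, rfl⟩
      exact ⟨[⟨A, a⟩], u, _, _, rfl, rfl, ⟨⟨a, [], rfl, rfl⟩, rfl⟩, hu, rfl⟩

theorem Circ.sem_symmA (I : Interp.{u} S) {A : S.Srt} {V : Mono S} :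
    ∀ {x y : I.Elt}, (Circ.symmA A V).sem I x y ↔
      ∃ (a : I.carrier A) (v : I.Elt), v.map Sigma.fst = V ∧ x = ⟨A, a⟩ :: v ∧
        y = v ++ [⟨A, a⟩] := by
  induction V with
  | nil => intro x y; simp [Circ.symmA, Circ.sem_idA]
  | cons B V ih =>
    intro x y
    simp only [Circ.symmA, Circ.sem, ih, map_fst_eq_cons, Circ.sem_idW, I.mem_iff]
    constructor
    · rintro ⟨z, ⟨x₁, x₂, y₁, y₂, rfl, rfl, ⟨a, b, rfl, rfl⟩, hx, rfl⟩,
        ⟨z₁, z₂, w₁, w₂, hz, rfl, ⟨⟨b', u, hu, rfl⟩, rfl⟩, ⟨a', v, hv, rfl, rfl⟩⟩⟩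
      obtain rfl := List.map_eq_nil_iff.1 hu
      simp at hz
      obtain ⟨rfl, rfl, rfl⟩ := hz
      exact ⟨a, _, ⟨b, _, hv, rfl⟩, rfl, rfl⟩
    · rintro ⟨a, _, ⟨b, v, hv, rfl⟩, rfl, rfl⟩
      exact ⟨_, ⟨[⟨A, a⟩, ⟨B, b⟩], v, _, v, rfl, rfl, ⟨a, b, rfl, rfl⟩, hv, rfl⟩,
        ⟨[⟨B, b⟩], ⟨A, a⟩ :: v, _, v ++ [⟨A, a⟩], rfl, rfl, ⟨⟨b, [], rfl, rfl⟩, rfl⟩, ⟨a, v, hv, rfl, rfl⟩⟩⟩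

theorem Circ.sem_symmW (I : Interp.{u} S) {U V : Mono S} :
    ∀ {x y : I.Elt}, (Circ.symmW U V).sem I x y ↔
      ∃ u v : I.Elt, u.map Sigma.fst = U ∧ v.map Sigma.fst = V ∧ x = u ++ v ∧ y = v ++ u := by
  induction U with
  | nil =>
    intro x y
    simp only [Circ.symmW, Circ.sem_idW, List.map_eq_nil_iff]
    constructor
    · rintro ⟨h, rfl⟩
      exact ⟨[], _, rfl, h, rfl, by simp⟩
    · rintro ⟨u, v, rfl, h, rfl, rfl⟩
      simpa using h
  | cons A U ih =>
    intro x y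
    simp only [Circ.symmW, Circ.sem, ih, map_fst_eq_cons, Circ.sem_idW, Circ.sem_symmA, I.mem_iff]
    constructor
    · rintro ⟨z, ⟨x₁, x₂, y₁, y₂, rfl, rfl, ⟨⟨a, u, hu, rfl⟩, rfl⟩, u, v, hu', hv, rfl, rfl⟩,
        ⟨z₁, z₂, w₁, w₂, hz, rfl, ⟨a', v', hv', rfl, rfl⟩, hz₂, rfl⟩⟩
      obtain rfl := List.map_eq_nil_iff.1 hu
      simp only [List.cons_append, List.nil_append, List.cons.injEq, Sigma.mk.injEq, heq_eq_eq,
        true_and] at hz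
      obtain ⟨rfl, hz⟩ := hz
      obtain ⟨rfl, rfl⟩ := append_inj_of_map_fst I hz hv hv'
      exact ⟨_, _, ⟨a, _, hu', rfl⟩, hv, rfl, by simp⟩
    · rintro ⟨_, v, ⟨a, u, hu, rfl⟩, hv, rfl, rfl⟩
      exact ⟨_, ⟨[⟨A, a⟩], u ++ v, _, v ++ u, rfl, rfl, ⟨⟨a, [], rfl, rfl⟩, rfl⟩,
        u, v, hu, hv, rfl, rfl⟩,
        ⟨⟨A, a⟩ :: v, u, _, _, rfl, by simp, ⟨a, v, hv, rfl, rfl⟩, hu, rfl⟩⟩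

theorem Circ.sem_copyW (I : Interp.{u} S) {U : Mono S} :
    ∀ {x y : I.Elt}, (Circ.copyW U).sem I x y ↔ x.map Sigma.fst = U ∧ y = x ++ x := by
  induction U with
  | nil =>
    intro x y
    simp +contextual [Circ.copyW, Circ.sem]
  | cons A U ih =>
    intro x y
    simp only [Circ.copyW, Circ.sem, ih, map_fst_eq_cons, Circ.sem_idW, Circ.sem_symmW,
      I.mem_iff]
    constructor
    · rintro ⟨z, ⟨x₁, x₂, y₁, y₂, rfl, rfl, ⟨a, rfl, rfl⟩, hx, rfl⟩,
        ⟨z₁, z₂, w₁, w₂, hz, rfl, ⟨z₃, z₄, w₃, w₄, rfl, rfl, ⟨⟨b, u, hu, rfl⟩, rfl⟩,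
          u', v', ⟨c, u'', hu'', rfl⟩, hv', rfl, rfl⟩, hz', rfl⟩⟩
      obtain rfl := List.map_eq_nil_iff.1 hu
      obtain rfl := List.map_eq_nil_iff.1 hu''
      simp only [List.cons_append, List.nil_append, List.cons.injEq, Sigma.mk.injEq, heq_eq_eq,
        true_and] at hz
      obtain ⟨rfl, rfl, hz⟩ := hz
      obtain ⟨rfl, rfl⟩ := append_inj_of_map_fst I hz hx hv'
      exact ⟨⟨a, _, hx, rfl⟩, by simp⟩
    · rintro ⟨⟨a, u, hu, rfl⟩, rfl⟩
      exact ⟨_, ⟨[⟨A, a⟩], u, _, _, rfl, rfl, ⟨a, rfl, rfl⟩, hu, rfl⟩,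
        ⟨⟨A, a⟩ :: ⟨A, a⟩ :: u, u, _, u, rfl, by simp, ⟨[⟨A, a⟩], ⟨A, a⟩ :: u, _, u ++ [⟨A, a⟩],
          rfl, rfl, ⟨⟨a, [], rfl, rfl⟩, rfl⟩,
          [⟨A, a⟩], u, ⟨a, [], rfl, rfl⟩, hu, rfl, rfl⟩, hu, rfl⟩⟩

theorem Circ.sem_cocopyW (I : Interp.{u} S) {U : Mono S} :
    ∀ {x y : I.Elt}, (Circ.cocopyW U).sem I x y ↔ y.map Sigma.fst = U ∧ x = y ++ y := by
  induction U with
  | nil =>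
    intro x y
    simp +contextual [Circ.cocopyW, Circ.sem, and_comm]
  | cons A U ih =>
    intro x y
    simp only [Circ.cocopyW, Circ.sem, ih, map_fst_eq_cons, Circ.sem_idW, Circ.sem_symmW,
      I.mem_iff]
    constructor
    · rintro ⟨z, ⟨z₁, z₂, w₁, w₂, rfl, rfl, ⟨z₃, z₄, w₃, w₄, rfl, rfl, ⟨⟨b, u, hu, rfl⟩, rfl⟩,
          u', v', hu', ⟨c, u'', hu'', rfl⟩, rfl, rfl⟩, hz', rfl⟩,
        ⟨x₁, x₂, y₁, y₂, hz, rfl, ⟨a, rfl, rfl⟩, hx, rfl⟩⟩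
      obtain rfl := List.map_eq_nil_iff.1 hu
      obtain rfl := List.map_eq_nil_iff.1 hu''
      simp only [List.cons_append, List.nil_append, List.cons.injEq, Sigma.mk.injEq, heq_eq_eq,
        true_and] at hz
      obtain ⟨rfl, rfl, hz⟩ := hz
      obtain ⟨rfl, rfl⟩ := append_inj_of_map_fst I hz hu' hx
      exact ⟨⟨_, _, hx, rfl⟩, by simp⟩
    · rintro ⟨⟨a, u, hu, rfl⟩, rfl⟩
      exact ⟨_, ⟨⟨A, a⟩ :: (u ++ [⟨A, a⟩]), u, ⟨A, a⟩ :: ⟨A, a⟩ :: u, u, by simp, rfl,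
          ⟨[⟨A, a⟩], u ++ [⟨A, a⟩], _, ⟨A, a⟩ :: u,
          rfl, rfl, ⟨⟨a, [], rfl, rfl⟩, rfl⟩,
          u, [⟨A, a⟩], hu, ⟨a, [], rfl, rfl⟩, rfl, rfl⟩, hu, rfl⟩,
          ⟨[⟨A, a⟩, ⟨A, a⟩], u ++ u, [⟨A, a⟩], u, rfl, rfl, ⟨a, rfl, rfl⟩, hu, rfl⟩⟩

theorem Circ.sem_discardW (I : Interp.{u} S) {U : Mono S} :
    ∀ {x y : I.Elt}, (Circ.discardW U).sem I x y ↔ x.map Sigma.fst = U ∧ y = [] := by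
  induction U with
  | nil => intro x y; simp [Circ.discardW, Circ.sem]
  | cons A U ih =>
    intro x y
    simp only [Circ.discardW, Circ.sem, ih, map_fst_eq_cons]
    constructor
    · rintro ⟨x₁, x₂, y₁, y₂, rfl, rfl, ⟨a, rfl, rfl⟩, h, rfl⟩
      exact ⟨⟨a, _, h, rfl⟩, rfl⟩
    · rintro ⟨⟨a, u, hu, rfl⟩, rfl⟩
      exact ⟨[⟨A, a⟩], u, [], [], rfl, rfl, ⟨a, rfl, rfl⟩, hu, rfl⟩

theorem Circ.sem_codiscardW (I : Interp.{u} S) {U : Mono S} :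
    ∀ {x y : I.Elt}, (Circ.codiscardW U).sem I x y ↔ y.map Sigma.fst = U ∧ x = [] := by
  induction U with
  | nil => intro x y; simp [Circ.codiscardW, Circ.sem, and_comm]
  | cons A U ih =>
    intro x y
    simp only [Circ.codiscardW, Circ.sem, ih, map_fst_eq_cons]
    constructor
    · rintro ⟨x₁, x₂, y₁, y₂, rfl, rfl, ⟨a, rfl, rfl⟩, h, rfl⟩
      exact ⟨⟨a, _, h, rfl⟩, rfl⟩
    · rintro ⟨⟨a, u, hu, rfl⟩, rfl⟩
      exact ⟨[], [], [⟨A, a⟩], u, rfl, rfl, ⟨a, rfl, rfl⟩, hu, rfl⟩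

/-- The opposite of a circuit denotes the converse relation. -/
theorem Circ.sem_op (I : Interp.{u} S) {U V : Mono S} {c : Circ S} (hc : c.HasType U V)
    {x y : I.Elt} : (Circ.op U V c).sem I x y ↔ c.sem I y x := by
  simp only [Circ.op, Circ.sem, Circ.sem_idW, Circ.sem_codiscardW, Circ.sem_copyW,
    Circ.sem_cocopyW, Circ.sem_discardW]
  constructor
  · rintro ⟨w, ⟨z, ⟨x₁, x₂, y₁, y₂, rfl, rfl, ⟨h₁, rfl⟩, ⟨u, ⟨hu, rfl⟩, -, rfl⟩⟩,
      ⟨z₁, z₂, w₁, w₂, hz, rfl, ⟨z₃, z₄, w₃, w₄, rfl, rfl, ⟨hz₃, rfl⟩, hzw⟩, hz₂, rfl⟩⟩,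
      ⟨v₁, v₂, v₃, v₄, hv, rfl, ⟨v, ⟨hv', rfl⟩, -, rfl⟩, hv₂, rfl⟩⟩
    have ht := hc.sem_typed I hzw
    rw [List.append_assoc] at hz
    obtain ⟨rfl, hz'⟩ := append_inj_of_map_fst I hz h₁ hz₃
    obtain ⟨rfl, rfl⟩ := append_inj_of_map_fst I hz' hu ht.1
    rw [List.append_assoc, List.append_assoc] at hv
    obtain ⟨rfl, hv''⟩ := append_inj_of_map_fst I hv h₁ hv'
    obtain ⟨rfl, rfl⟩ := append_inj_of_map_fst I hv'' ht.2 hv'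
    simpa using hzw
  · intro h
    obtain ⟨hy, hx⟩ := hc.sem_typed I h
    -- The cup creates the pair `y ++ y`, then `c` turns its first copy into `x`, and the cap
    -- consumes `x ++ x`, leaving the second `y`.
    exact ⟨x ++ x ++ y, ⟨x ++ (y ++ y), ⟨x, [], x, y ++ y, by simp, rfl, ⟨hx, rfl⟩,
        ⟨y, ⟨hy, rfl⟩, hy, rfl⟩⟩,
      ⟨x ++ y, y, x ++ x, y, by simp, rfl, ⟨x, y, x, x, rfl, rfl, ⟨hx, rfl⟩, h⟩, hy, rfl⟩⟩,
      ⟨x ++ x, y, [], y, rfl, rfl, ⟨x, ⟨hx, rfl⟩, hx, rfl⟩, hy, rfl⟩⟩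

theorem Circ.AxEq.sound (I : Interp.{u} S) {c d : Circ S} (h : Circ.AxEq c d) {U V : Mono S}
    (hc : c.HasType U V) (hd : d.HasType U V) {x y : I.Elt} : c.sem I x y ↔ d.sem I x y := by
  cases h with
  | assoc f g h =>
    simp only [Circ.sem]
    exact ⟨fun ⟨z, ⟨w, h₁, h₂⟩, h₃⟩ => ⟨w, h₁, z, h₂, h₃⟩,
      fun ⟨w, h₁, z, h₂, h₃⟩ => ⟨z, ⟨w, h₁, h₂⟩, h₃⟩⟩
  | id_seq W =>
    simp only [Circ.sem, Circ.sem_idW]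
    have hW : W = U := by rw [← hc.dom_cod.1, Circ.dom, (Circ.idW_typed W).dom_cod.1]
    subst hW
    constructor
    · rintro ⟨z, ⟨-, rfl⟩, h⟩; exact h
    · intro h; exact ⟨x, ⟨(hd.sem_typed I h).1, rfl⟩, h⟩
  | seq_id _ W =>
    simp only [Circ.sem, Circ.sem_idW]
    have hW : W = V := by rw [← hc.dom_cod.2, Circ.cod, (Circ.idW_typed W).dom_cod.2]
    subst hW
    constructor
    · rintro ⟨z, h, -, rfl⟩; exact h
    · intro h; exact ⟨y, h, (hd.sem_typed I h).2, rfl⟩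
  | interchange f₁ f₂ g₁ g₂ =>
    -- The typing of the right-hand side is the one to invert: it makes `f₁` and `g₁` composable,
    -- whereas on the left only the concatenated middle words are known to agree.
    cases hd with | ten h₁ h₂ =>
    cases h₁ with | seq hf₁ hg₁ =>
    cases h₂ with | seq hf₂ hg₂ =>
    simp only [Circ.sem]
    constructor
    · rintro ⟨z, ⟨x₁, x₂, y₁, y₂, rfl, rfl, h₁, h₂⟩, ⟨z₁, z₂, w₁, w₂, hz, rfl, h₃, h₄⟩⟩
      obtain ⟨rfl, rfl⟩ := append_inj_of_map_fst I hz (hf₁.sem_typed I h₁).2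
        (hg₁.sem_typed I h₃).1
      exact ⟨_, _, _, _, rfl, rfl, ⟨_, h₁, h₃⟩, ⟨_, h₂, h₄⟩⟩
    · rintro ⟨x₁, x₂, y₁, y₂, rfl, rfl, ⟨z, h₁, h₃⟩, ⟨w, h₂, h₄⟩⟩
      exact ⟨_, ⟨_, _, _, _, rfl, rfl, h₁, h₂⟩, ⟨_, _, _, _, rfl, rfl, h₃, h₄⟩⟩
  | one_ten => simp [Circ.sem]
  | ten_one => simp [Circ.sem]
  | ten_assoc f g h =>
    simp only [Circ.sem]
    constructor
    · rintro ⟨_, x₃, _, y₃, rfl, rfl, ⟨x₁, x₂, y₁, y₂, rfl, rfl, h₁, h₂⟩, h₃⟩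
      exact ⟨_, _, _, _, by simp, by simp, h₁, _, _, _, _, rfl, rfl, h₂, h₃⟩
    · rintro ⟨x₁, _, y₁, _, rfl, rfl, h₁, x₂, x₃, y₂, y₃, rfl, rfl, h₂, h₃⟩
      exact ⟨_, _, _, _, by simp, by simp, ⟨_, _, _, _, rfl, rfl, h₁, h₂⟩, h₃⟩
  | symm_nat f U V W hf =>
    simp only [Circ.sem, Circ.sem_idW, Circ.sem_symmW]
    constructor
    · rintro ⟨z, ⟨x₁, x₂, y₁, y₂, rfl, rfl, h₁, h₂, rfl⟩, u, v, hu, hv, hz, rfl⟩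
      have ht := hf.sem_typed I h₁
      obtain ⟨rfl, rfl⟩ := append_inj_of_map_fst I hz ht.2 hu
      exact ⟨_, ⟨_, _, ht.1, hv, rfl, rfl⟩, _, _, _, _, rfl, rfl, ⟨hv, rfl⟩, h₁⟩
    · rintro ⟨z, ⟨u, v, hu, hv, rfl, rfl⟩, x₁, x₂, y₁, y₂, hz, rfl, ⟨h₂, rfl⟩, h₁⟩
      have ht := hf.sem_typed I h₁
      obtain ⟨rfl, rfl⟩ := append_inj_of_map_fst I hz hv h₂
      exact ⟨_, ⟨_, _, _, _, rfl, rfl, h₁, hv, rfl⟩, _, _, ht.2, hv, rfl, rfl⟩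
  | _ =>
    simp only [Circ.sem_seq, Circ.sem_ten, Circ.sem_idA]
    simp [Circ.sem]

/-- An arbitrary relation is only laxly natural for copying and discarding: one input may have
several outputs, or none. Each inclusion is witnessed by reusing the given output. -/
theorem Circ.AxLe.sound (I : Interp.{u} S) {c d : Circ S} (h : Circ.AxLe c d) {x y : I.Elt}
    (hx : c.sem I x y) : d.sem I x y := by
  cases h with
  | copy_nat s =>
    obtain ⟨_, ⟨a, b, rfl, rfl, h⟩, h'⟩ := hx
    rw [Circ.sem_copyW] at h'
    obtain ⟨-, rfl⟩ := h'
    exact ⟨_, (Circ.sem_copyW I).2 ⟨a.map_fst_toList, rfl⟩, _, _, _, _, rfl, rfl,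
      ⟨a, b, rfl, rfl, h⟩, ⟨a, b, rfl, rfl, h⟩⟩
  | discard_nat s =>
    obtain ⟨_, ⟨a, b, rfl, rfl, h⟩, h'⟩ := hx
    rw [Circ.sem_discardW] at h'
    exact (Circ.sem_discardW I).2 ⟨a.map_fst_toList, h'.2⟩
  | copy_cocopy A =>
    obtain ⟨a, rfl, rfl⟩ := (Circ.sem_idA I).1 hx
    exact ⟨_, ⟨a, rfl, rfl⟩, a, rfl, rfl⟩
  | cocopy_copy A =>
    obtain ⟨_, ⟨a, rfl, rfl⟩, b, h, rfl⟩ := hx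
    rw [← h]
    exact ⟨[_], [_], [_], [_], rfl, by simpa using h.symm,
      (Circ.sem_idA I).2 ⟨a, rfl, rfl⟩, (Circ.sem_idA I).2 ⟨a, rfl, rfl⟩⟩
  | discard_codiscard A =>
    obtain ⟨a, rfl, rfl⟩ := (Circ.sem_idA I).1 hx
    exact ⟨_, ⟨a, rfl, rfl⟩, a, rfl, rfl⟩
  | codiscard_discard A =>
    obtain ⟨_, ⟨a, rfl, rfl⟩, b, h, rfl⟩ := hx
    exact ⟨rfl, rfl⟩

/-! ### Typing of the semantics of tapes -/

/-- `x ∈ ⟦P⟧`. -/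
def Interp.PMem (I : Interp.{u} S) (P : Poly S) (x : ℕ × I.Elt) : Prop :=
  P[x.1]? = some (x.2.map Sigma.fst)

theorem Interp.PMem.lt {I : Interp.{u} S} {P : Poly S} {x : ℕ × I.Elt} (h : I.PMem P x) :
    x.1 < P.length :=
  (List.getElem?_eq_some_iff.1 h).1

theorem Interp.pmem_nil (I : Interp.{u} S) {x : ℕ × I.Elt} : ¬ I.PMem [] x := by
  simp [Interp.PMem]

theorem Interp.pmem_singleton (I : Interp.{u} S) {U : Mono S} {x : ℕ × I.Elt} :
    I.PMem [U] x ↔ x.1 = 0 ∧ x.2.map Sigma.fst = U := by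
  rcases x with ⟨_ | i, a⟩ <;> simp [Interp.PMem, eq_comm]

theorem Interp.pmem_append (I : Interp.{u} S) {P Q : Poly S} {x : ℕ × I.Elt} :
    I.PMem (P ++ Q) x ↔ I.PMem P x ∨ P.length ≤ x.1 ∧ I.PMem Q (x.1 - P.length, x.2) := by
  rcases lt_or_ge x.1 P.length with h | h
  · simp [Interp.PMem, List.getElem?_append_left h, h]
  · have : P[x.1]? = none := by simpa using h
    simp [Interp.PMem, List.getElem?_append_right h, h]

theorem Interp.PMem.append_left {I : Interp.{u} S} {P : Poly S} {x : ℕ × I.Elt}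
    (h : I.PMem P x) (Q : Poly S) : I.PMem (P ++ Q) x :=
  I.pmem_append.2 (.inl h)

theorem Interp.pmem_append_shift (I : Interp.{u} S) {P Q : Poly S} {i : ℕ} {a : I.Elt} :
    I.PMem (P ++ Q) (P.length + i, a) ↔ I.PMem Q (i, a) := by
  simp [Interp.PMem, List.getElem?_append_right]

theorem Tape.HasType.sem_typed (I : Interp.{u} S) {t : Tape S} {P Q : Poly S}
    (h : t.HasType P Q) : ∀ {x y}, t.sem I x y → I.PMem P x ∧ I.PMem Q y := by
  induction h with
  | idU U =>
    rintro x y ⟨h₁, h₂, rfl⟩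
    simpa [I.pmem_singleton, h₁] using I.mem_iff.1 h₂
  | idZero => rintro x y ⟨⟩
  | circ hc =>
    rintro x y ⟨h₁, h₂, h⟩
    simpa [I.pmem_singleton, h₁, h₂] using hc.sem_typed I h
  | symm U V =>
    rintro ⟨i, a⟩ y (⟨h₁, h₂, rfl⟩ | ⟨h₁, h₂, rfl⟩) <;>
      rw [I.mem_iff] at h₂ <;> simp_all [Interp.PMem]
  | seq _ _ ih₁ ih₂ =>
    rintro x y ⟨z, h₁, h₂⟩
    exact ⟨(ih₁ h₁).1, (ih₂ h₂).2⟩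
  | par h₁ h₂ ih₁ ih₂ =>
    rintro x y (h | ⟨i, j, a, b, rfl, rfl, h⟩)
    · exact ⟨(ih₁ h).1.append_left _, (ih₁ h).2.append_left _⟩
    · rw [h₁.dom_cod.1, h₁.dom_cod.2, I.pmem_append_shift, I.pmem_append_shift]
      exact ih₂ h
  | bang U => rintro x y ⟨⟩
  | diag U =>
    rintro ⟨i, a⟩ y ⟨h₁, h₂, rfl | rfl⟩ <;> rw [I.mem_iff] at h₂ <;> simp_all [Interp.PMem]
  | cobang U => rintro x y ⟨⟩
  | codiag U =>
    rintro ⟨i, a⟩ y ⟨h₁ | h₁, h₂, rfl⟩ <;> rw [I.mem_iff] at h₂ <;> simp_all [Interp.PMem]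
  | tr _ ih =>
    rintro x y (h | ⟨a, b, h, -, h'⟩)
    · simpa [Interp.PMem] using ih h
    · have h₁ := (ih h).1
      have h₂ := (ih h').2
      exact ⟨by simpa [Interp.PMem] using h₁, by simpa [Interp.PMem] using h₂⟩

theorem Tape.sem_seq (I : Interp.{u} S) {t s : Tape S} {x y} :
    (t ⨟ₜ s).sem I x y ↔ ∃ z, t.sem I x z ∧ s.sem I z y := Iff.rfl

/-- Replaces the existential shift of tags by subtraction, in a form suited to linear arithmetic;
the two bounds keep truncated subtraction honest. -/
theorem Tape.sem_par (I : Interp.{u} S) {t s : Tape S} {x y} :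
    (t ⊞ₜ s).sem I x y ↔ t.sem I x y ∨ t.dom.length ≤ x.1 ∧ t.cod.length ≤ y.1 ∧
      s.sem I (x.1 - t.dom.length, x.2) (y.1 - t.cod.length, y.2) := by
  rcases x with ⟨i, a⟩
  rcases y with ⟨j, b⟩
  refine or_congr Iff.rfl ⟨?_, fun ⟨h₁, h₂, h⟩ => ?_⟩
  · rintro ⟨i, j, a, b, h₁, h₂, h⟩
    cases h₁
    cases h₂
    simpa using h
  · exact ⟨_, _, a, b, by simp only [Nat.add_sub_cancel' h₁],
      by simp only [Nat.add_sub_cancel' h₂], h⟩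

/-! ### Traces as runs -/

/-- `Run n f x (j, b)` means that `f` leads from `x` to `(n + j, b)` through states with index
below `n`. -/
inductive Run {E : Type u} (n : ℕ) (f : ℕ × E → ℕ × E → Prop) : ℕ × E → ℕ × E → Prop
  | done {x : ℕ × E} {j : ℕ} {b : E} : f x (j + n, b) → Run n f x (j, b)
  | step {x z y : ℕ × E} : z.1 < n → f x z → Run n f z y → Run n f x y

namespace Run

variable {E : Type u} {f g : ℕ × E → ℕ × E → Prop}

theorem zero_iff {x y : ℕ × E} : Run 0 f x y ↔ f x y := by
  constructor
  · rintro (h | ⟨h, -, -⟩)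
    · exact h
    · exact absurd h (Nat.not_lt_zero _)
  · exact fun h => .done h

theorem exists_start {n : ℕ} {x y : ℕ × E} (h : Run n f x y) : ∃ z, f x z := by
  cases h with
  | done h => exact ⟨_, h⟩
  | step _ h _ => exact ⟨_, h⟩

/-- With one traced summand all intermediate states have index `0`, so the loop is a
reflexive-transitive closure. This identifies runs with the trace formula. -/
theorem one_iff {x y : ℕ × E} :
    Run 1 f x y ↔ f x (y.1 + 1, y.2) ∨ ∃ a b, f x (0, a) ∧
      Relation.ReflTransGen (fun c d => f (0, c) (0, d)) a b ∧ f (0, b) (y.1 + 1, y.2) := by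
  constructor
  · intro h
    induction h with
    | done h => exact .inl h
    | @step x z y hz h _ ih =>
      obtain ⟨k, c⟩ := z
      obtain rfl : k = 0 := by simpa using hz
      right
      rcases ih with h' | ⟨a, b, h₁, h₂, h₃⟩
      · exact ⟨c, c, h, .refl, h'⟩
      · exact ⟨c, b, h, .head h₁ h₂, h₃⟩
  · rintro (h | ⟨a, b, h₁, h₂, h₃⟩)
    · exact .done h
    · refine .step (z := (0, a)) Nat.one_pos h₁ ?_
      clear h₁
      induction h₂ using Relation.ReflTransGen.head_induction_on with
      | refl => exact .done h₃
      | head h _ ih => exact .step (z := (0, _)) Nat.one_pos h ih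

theorem one_done {n j : ℕ} {x : ℕ × E} {b : E} (h : Run 1 f x (j + n, b)) :
    Run (n + 1) f x (j, b) := by
  generalize hy : (j + n, b) = y at h
  induction h with
  | done h => cases hy; exact .done h
  | step hz h _ ih => exact .step (by omega) h (ih hy)

/-- Leaving the inner trace lowers the index by one, so the run resumes at `z.1 + 1`. -/
theorem one_step {n : ℕ} {x y z : ℕ × E} (hz : z.1 < n) (h : Run 1 f x z)
    (h' : Run (n + 1) f (z.1 + 1, z.2) y) : Run (n + 1) f x y := by
  induction h with
  | done h => exact .step (Nat.succ_lt_succ hz) h h'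
  | step hw h _ ih => exact .step (by omega) h (ih hz h')

/-- Tracing along `U` and then along `R` is tracing along `U ⊕ R`. -/
theorem run_one_iff {n : ℕ} {x y : ℕ × E} :
    Run n (fun x y => Run 1 f (x.1 + 1, x.2) y) x y ↔ Run (n + 1) f (x.1 + 1, x.2) y := by
  constructor
  · intro h
    induction h with
    | done h => exact one_done h
    | step hz h _ ih => exact one_step hz h ih
  · intro h
    -- Cut the run at the first state after `w` whose index is not `0`: it is either the final exit,
    -- or a state that the outer run sees with its index lowered by one.
    have key : ∀ {w}, Run (n + 1) f w y → Run 1 f w (y.1 + n, y.2) ∨ ∃ z, z.1 < n ∧ Run 1 f w z ∧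
        Run n (fun x y => Run 1 f (x.1 + 1, x.2) y) z y := by
      intro w hw
      clear h
      induction hw with
      | done h => exact .inl (.done (by simpa [add_assoc] using h))
      | @step x z y hz h _ ih =>
        obtain ⟨_ | k, c⟩ := z
        · rcases ih with h' | ⟨z, hz', h₁, h₂⟩
          · exact .inl (.step Nat.one_pos h h')
          · exact .inr ⟨z, hz', .step Nat.one_pos h h₁, h₂⟩
        · refine .inr ⟨(k, c), by simpa using hz, .done h, ?_⟩
          rcases ih with h' | ⟨z, hz', h₁, h₂⟩
          · exact .done h'
          · exact .step hz' h₁ h₂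
    rcases key h with h' | ⟨z, hz', h₁, h₂⟩
    · exact .done h'
    · exact .step hz' h₁ h₂

/-- The relation `s ⊕ id` on indexed elements, where `s` relates indices below `m` to indices
below `n`. -/
def ParId (m n : ℕ) (s : ℕ × E → ℕ × E → Prop) (M : ℕ × E → Prop) (x y : ℕ × E) : Prop :=
  s x y ∨ ∃ i a, x = (i + m, a) ∧ y = (i + n, a) ∧ M (i, a)

/-- Simulate backwards from the exit. If the rest of the `f`-run from `z` is matched by a `g`-run
from some `z'` with `s₂ z z'`, then `s₁ z z'` holds as well, and the square pulls this back along
the preceding step to an `s₂ ⊕ id`-related state. The inclusion of `s₂` in `s₁` is what lets the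
induction continue. -/
theorem uniformity_right {m n : ℕ} {s₁ s₂ : ℕ × E → ℕ × E → Prop} {M N : ℕ × E → Prop}
    (hs : ∀ x y, s₂ x y → s₁ x y) (hlt : ∀ x y, s₂ x y → x.1 < m ∧ y.1 < n)
    (hN : ∀ x j b, f x (j + m, b) → N (j, b))
    (h : ∀ x z y, f x z → ParId m n s₁ N z y → ∃ w, ParId m n s₂ M x w ∧ g w y)
    {x y : ℕ × E} (hr : Run m f (x.1 + m, x.2) y) : Run n g (x.1 + n, x.2) y := by
  have key : ∀ {w}, Run m f w y → ∃ w', ParId m n s₂ M w w' ∧ Run n g w' y := by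
    intro w hw
    clear hr
    induction hw with
    | @done x j b hx =>
      obtain ⟨w, hw, hg⟩ := h _ _ (j + n, b) hx (.inr ⟨j, b, rfl, rfl, hN _ _ _ hx⟩)
      exact ⟨w, hw, .done hg⟩
    | @step x z y hz hx _ ih =>
      obtain ⟨z', hz' | ⟨i, a, rfl, -, -⟩, hr⟩ := ih
      · obtain ⟨w, hw, hg⟩ := h _ _ _ hx (.inl (hs _ _ hz'))
        exact ⟨w, hw, .step (hlt _ _ hz').2 hg hr⟩
      · exact absurd hz (by simp)
  obtain ⟨w, hw | ⟨i, a, h₁, rfl, -⟩, hr'⟩ := key hr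
  -- The start lies outside the traced summands, so only the identity part can relate it.
  · exact absurd (hlt _ _ hw).1 (by simp)
  · simp only [Prod.mk.injEq, Nat.add_right_cancel_iff] at h₁
    rwa [h₁.1, h₁.2]

/-- The forward simulation: a state `w'` that is `s₁ ⊕ id`-related to `w` matches each `f`-step from
`w` by a `g`-step, landing in `s₂ ⊕ id`. Inside the trace this is again contained in `s₁`; at the
exit it is the identity. -/
theorem uniformity_left {m n : ℕ} {s₁ s₂ : ℕ × E → ℕ × E → Prop} {M N : ℕ × E → Prop}
    (hs : ∀ x y, s₂ x y → s₁ x y) (hlt : ∀ x y, s₂ x y → x.1 < n ∧ y.1 < m)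
    (hM : ∀ i a z, f (i + m, a) z → M (i, a))
    (h : ∀ x z y, ParId n m s₁ M x z → f z y → ∃ w, g x w ∧ ParId n m s₂ N w y)
    {x y : ℕ × E} (hr : Run m f (x.1 + m, x.2) y) : Run n g (x.1 + n, x.2) y := by
  have key : ∀ {w}, Run m f w y → ∀ w', ParId n m s₁ M w' w → Run n g w' y := by
    intro w hw
    clear hr
    induction hw with
    | @done x j b hx =>
      intro w' hw
      obtain ⟨z, hz, hz' | ⟨i, a, rfl, h₂, -⟩⟩ := h _ _ _ hw hx
      · exact absurd (hlt _ _ hz').2 (by simp)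
      · simp only [Prod.mk.injEq, Nat.add_right_cancel_iff] at h₂
        rw [h₂.1, h₂.2]
        exact .done hz
    | @step x z y hz hx _ ih =>
      intro w' hw
      obtain ⟨z', hz', hs' | ⟨i, a, -, rfl, -⟩⟩ := h _ _ _ hw hx
      · exact .step (hlt _ _ hs').1 hz' (ih _ (.inl (hs _ _ hs')))
      · exact absurd hz (by simp)
  -- The first step shows that the start satisfies `M`, so that the identity part relates it to
  -- itself.
  obtain ⟨z, hz⟩ := hr.exists_start
  exact key hr _ (.inr ⟨_, _, rfl, rfl, hM _ _ _ hz⟩)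

end Run

theorem Tape.sem_tr (I : Interp.{u} S) {U : Mono S} {t : Tape S} {x y} :
    (Tape.tr U t).sem I x y ↔ Run 1 (t.sem I) (x.1 + 1, x.2) y :=
  Run.one_iff.symm

theorem Tape.sem_trP (I : Interp.{u} S) {R : Poly S} : ∀ {t : Tape S} {x y},
    (Tape.trP R t).sem I x y ↔ Run R.length (t.sem I) (x.1 + R.length, x.2) y := by
  induction R with
  | nil => intro t x y; exact Run.zero_iff.symm
  | cons U R ih =>
    intro t x y
    have : (Tape.tr U t).sem I = fun x y => Run 1 (t.sem I) (x.1 + 1, x.2) y := by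
      funext x y
      exact propext (Tape.sem_tr I)
    rw [Tape.trP, ih, this, Run.run_one_iff]
    rfl

/-! ### Typing and monotonicity of the product of tapes -/

theorem Poly.mul_cons (U : Mono S) (P Q : Poly S) :
    Poly.mul (U :: P) Q = Q.map (U ++ ·) ++ Poly.mul P Q := by
  simp [Poly.mul]

theorem Poly.singleton_mul (U : Mono S) (Q : Poly S) : Poly.mul [U] Q = Q.map (U ++ ·) := by
  simp [Poly.mul]

theorem Poly.mul_singleton (P : Poly S) (V : Mono S) : Poly.mul P [V] = P.map (· ++ V) := by
  simp [Poly.mul, List.map_eq_flatMap]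

theorem Poly.mul_nil (P : Poly S) : Poly.mul P [] = [] := by
  simp [Poly.mul]

theorem Tape.lwU_typed (U : Mono S) {t : Tape S} {P Q : Poly S} (h : t.HasType P Q) :
    (Tape.lwU U t).HasType (P.map (U ++ ·)) (Q.map (U ++ ·)) := by
  induction h with
  | idU V => exact .idU _
  | idZero => exact .idZero
  | circ hc => exact .circ (.ten (Circ.idW_typed U) hc)
  | symm V W => exact .symm _ _
  | seq _ _ ih₁ ih₂ => exact .seq ih₁ ih₂
  | par _ _ ih₁ ih₂ => simpa [Tape.lwU] using Tape.HasType.par ih₁ ih₂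
  | bang V => exact .bang _
  | diag V => exact .diag _
  | cobang V => exact .cobang _
  | codiag V => exact .codiag _
  | tr _ ih => exact .tr ih

theorem Tape.rwU_typed (U : Mono S) {t : Tape S} {P Q : Poly S} (h : t.HasType P Q) :
    (Tape.rwU U t).HasType (P.map (· ++ U)) (Q.map (· ++ U)) := by
  induction h with
  | idU V => exact .idU _
  | idZero => exact .idZero
  | circ hc => exact .circ (.ten hc (Circ.idW_typed U))
  | symm V W => exact .symm _ _
  | seq _ _ ih₁ ih₂ => exact .seq ih₁ ih₂
  | par _ _ ih₁ ih₂ => simpa [Tape.rwU] using Tape.HasType.par ih₁ ih₂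
  | bang V => exact .bang _
  | diag V => exact .diag _
  | cobang V => exact .cobang _
  | codiag V => exact .codiag _
  | tr _ ih => exact .tr ih

theorem Tape.dl_typed (P Q R : Poly S) :
    (Tape.dl P Q R).HasType (Poly.mul P (Q ++ R)) (Poly.mul P Q ++ Poly.mul P R) := by
  induction P with
  | nil => exact .idZero
  | cons U P ih =>
    have h₁ := Tape.HasType.par (Tape.idP_typed (Poly.mul [U] (Q ++ R))) ih
    have h₂ := Tape.HasType.par (.par (Tape.idP_typed (Poly.mul [U] Q))
      (Tape.symmP_typed (Poly.mul [U] R) (Poly.mul P Q))) (Tape.idP_typed (Poly.mul P R))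
    rw [Poly.singleton_mul, List.map_append] at h₁
    rw [Poly.singleton_mul, Poly.singleton_mul] at h₂
    rw [Poly.mul_cons, Poly.mul_cons, Poly.mul_cons, List.map_append]
    simp only [List.append_assoc] at h₁ h₂ ⊢
    simpa [Tape.dl, Poly.singleton_mul] using Tape.HasType.seq h₁ h₂

theorem Tape.dlInv_typed (P Q R : Poly S) :
    (Tape.dlInv P Q R).HasType (Poly.mul P Q ++ Poly.mul P R) (Poly.mul P (Q ++ R)) := by
  induction P with
  | nil => exact .idZero
  | cons U P ih =>
    have h₁ := Tape.HasType.par (Tape.idP_typed (Poly.mul [U] (Q ++ R))) ih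
    have h₂ := Tape.HasType.par (.par (Tape.idP_typed (Poly.mul [U] Q))
      (Tape.symmP_typed (Poly.mul P Q) (Poly.mul [U] R))) (Tape.idP_typed (Poly.mul P R))
    rw [Poly.singleton_mul, List.map_append] at h₁
    rw [Poly.singleton_mul, Poly.singleton_mul] at h₂
    rw [Poly.mul_cons, Poly.mul_cons, Poly.mul_cons, List.map_append]
    simp only [List.append_assoc] at h₁ h₂ ⊢
    simpa [Tape.dlInv, Poly.singleton_mul] using Tape.HasType.seq h₂ h₁

theorem Tape.lwP_typed (P : Poly S) {t : Tape S} {Q R : Poly S} (h : t.HasType Q R) :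
    (Tape.lwP P t).HasType (Poly.mul P Q) (Poly.mul P R) := by
  induction P with
  | nil => exact .idZero
  | cons U P ih =>
    rw [Poly.mul_cons, Poly.mul_cons]
    exact .par (Tape.lwU_typed U h) ih

theorem Tape.rwP_typed (R : Poly S) {t : Tape S} {P Q : Poly S} (h : t.HasType P Q) :
    (Tape.rwP R t).HasType (Poly.mul P R) (Poly.mul Q R) := by
  induction R with
  | nil =>
    rw [Poly.mul_nil, Poly.mul_nil]
    exact .idZero
  | cons W R ih =>
    have h₁ := Tape.dl_typed P [W] R
    have h₂ := Tape.dlInv_typed Q [W] R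
    have h₃ := Tape.HasType.par (Tape.rwU_typed W h) ih
    rw [← Poly.mul_singleton, ← Poly.mul_singleton] at h₃
    rw [Tape.rwP, h.dom_cod.1, h.dom_cod.2]
    exact .seq (.seq h₁ h₃) h₂

theorem Tape.ten_typed {t s : Tape S} {P Q P' Q' : Poly S} (ht : t.HasType P Q)
    (hs : s.HasType P' Q') : (Tape.ten t s).HasType (Poly.mul P P') (Poly.mul Q Q') := by
  rw [Tape.ten, ht.dom_cod.1, hs.dom_cod.2]
  exact .seq (Tape.lwP_typed P hs) (Tape.rwP_typed Q' ht)

/-- Both sides of an inequality therefore share `dom` and `cod`, on which the tag shifts of `⊞ₜ` and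
the distributors inside `Tape.ten` depend. -/
theorem Tape.Le.typed {J : Tape S → Tape S → Prop} {P Q : Poly S} {t s : Tape S}
    (h : Tape.Le J P Q t s) : t.HasType P Q ∧ s.HasType P Q := by
  induction h with
  | ax _ ht hs => exact ⟨ht, hs⟩
  | refl ht => exact ⟨ht, ht⟩
  | trans _ _ ih₁ ih₂ => exact ⟨ih₁.1, ih₂.2⟩
  | seq _ _ ih₁ ih₂ => exact ⟨.seq ih₁.1 ih₂.1, .seq ih₁.2 ih₂.2⟩
  | par _ _ ih₁ ih₂ => exact ⟨.par ih₁.1 ih₂.1, .par ih₁.2 ih₂.2⟩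
  | ten _ _ ih₁ ih₂ => exact ⟨Tape.ten_typed ih₁.1 ih₂.1, Tape.ten_typed ih₁.2 ih₂.2⟩
  | unif_r h₁ h₂ => exact ⟨Tape.trP_typed _ h₁, Tape.trP_typed _ h₂⟩
  | unif_l h₁ h₂ => exact ⟨Tape.trP_typed _ h₁, Tape.trP_typed _ h₂⟩

/-! ### Semantics of whiskering -/

theorem Tape.length_dom_lwU (U : Mono S) (t : Tape S) :
    (Tape.lwU U t).dom.length = t.dom.length := by
  induction t <;> simp_all [Tape.lwU, Tape.dom]

theorem Tape.length_cod_lwU (U : Mono S) (t : Tape S) :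
    (Tape.lwU U t).cod.length = t.cod.length := by
  induction t <;> simp_all [Tape.lwU, Tape.cod]

theorem Tape.length_dom_rwU (U : Mono S) (t : Tape S) :
    (Tape.rwU U t).dom.length = t.dom.length := by
  induction t <;> simp_all [Tape.rwU, Tape.dom]

theorem Tape.length_cod_rwU (U : Mono S) (t : Tape S) :
    (Tape.rwU U t).cod.length = t.cod.length := by
  induction t <;> simp_all [Tape.rwU, Tape.cod]

/-- If `f` is `g` under a parameter `w` that is determined by, and constant along, the states of
`f`, then so are the runs of `f`. -/
theorem Run.whisker {E : Type u} {W : Type v} {f g : ℕ × E → ℕ × E → Prop} {n : ℕ}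
    {θ : W → E → E → Prop} (hinj : ∀ {w w' a a' x}, θ w a x → θ w' a' x → w = w' ∧ a = a')
    (hex : ∀ {w a x}, θ w a x → ∀ c, ∃ z, θ w c z)
    (hf : ∀ {x y}, f x y ↔ ∃ w a b, θ w a x.2 ∧ θ w b y.2 ∧ g (x.1, a) (y.1, b))
    {x y : ℕ × E} :
    Run n f x y ↔ ∃ w a b, θ w a x.2 ∧ θ w b y.2 ∧ Run n g (x.1, a) (y.1, b) := by
  constructor
  · intro h
    induction h with
    | done h =>
      obtain ⟨w, a, b, ha, hb, hg⟩ := hf.1 h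
      exact ⟨w, a, b, ha, hb, .done hg⟩
    | @step x z y hz h _ ih =>
      obtain ⟨w, a, c, ha, hc, hg⟩ := hf.1 h
      obtain ⟨w', c', b, hc', hb, hr⟩ := ih
      obtain ⟨rfl, rfl⟩ := hinj hc hc'
      exact ⟨w, a, b, ha, hb, .step (z := (z.1, c)) hz hg hr⟩
  · rintro ⟨w, a, b, ha, hb, h⟩
    obtain ⟨i, x⟩ := x
    obtain ⟨j, y⟩ := y
    simp only at ha hb h
    generalize hx' : (i, a) = x' at h
    generalize hy' : (j, b) = y' at h
    induction h generalizing i a x with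
    | done h =>
      cases hx'
      cases hy'
      exact .done (hf.2 ⟨w, _, _, ha, hb, h⟩)
    | @step x' z y' hz h _ ih =>
      cases hx'
      obtain ⟨c, hc⟩ := hex ha z.2
      exact .step (z := (z.1, c)) hz (hf.2 ⟨w, _, _, ha, hc, h⟩) (ih _ _ _ hc rfl hy')

/-- The component in `U` is carried along unchanged by every constructor. At a composition the two
prefixes of the middle state agree because both have sorts `U`; around a trace the prefix is
constant along the whole run, by `Run.whisker`. -/
theorem Tape.sem_lwU (I : Interp.{u} S) (U : Mono S) (t : Tape S) : ∀ {x y},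
    (Tape.lwU U t).sem I x y ↔ ∃ u a b, u.map Sigma.fst = U ∧ x.2 = u ++ a ∧ y.2 = u ++ b ∧
      t.sem I (x.1, a) (y.1, b) := by
  induction t with
  | idU V =>
    rintro ⟨i, x⟩ ⟨j, y⟩
    simp only [Tape.lwU, Tape.sem, I.mem_iff, map_fst_eq_append, Prod.mk.injEq]
    grind
  | idZero => simp [Tape.lwU, Tape.sem]
  | circ c =>
    rintro ⟨i, x⟩ ⟨j, y⟩
    simp only [Tape.lwU, Tape.sem, Circ.sem_ten, Circ.sem_idW]
    grind
  | symm V W =>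
    rintro ⟨i, x⟩ ⟨j, y⟩
    simp only [Tape.lwU, Tape.sem, I.mem_iff, map_fst_eq_append, Prod.mk.injEq]
    grind
  | seq t s ih₁ ih₂ =>
    intro x y
    simp only [Tape.lwU, Tape.sem_seq, ih₁, ih₂]
    constructor
    · rintro ⟨⟨k, z⟩, ⟨u, a, b, hu, hx, hz, h₁⟩, v, c, d, hv, hz', hy, h₂⟩
      obtain ⟨rfl, rfl⟩ := append_inj_of_map_fst I (hz.symm.trans hz') hu hv
      exact ⟨u, a, d, hu, hx, hy, _, h₁, h₂⟩
    · rintro ⟨u, a, d, hu, hx, hy, z, h₁, h₂⟩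
      exact ⟨(z.1, u ++ z.2), ⟨u, a, z.2, hu, hx, rfl, h₁⟩, u, z.2, d, hu, rfl, hy, h₂⟩
  | par t s ih₁ ih₂ =>
    intro x y
    simp only [Tape.lwU, Tape.sem_par, ih₁, ih₂, Tape.length_dom_lwU, Tape.length_cod_lwU]
    grind
  | bang V => simp [Tape.lwU, Tape.sem]
  | diag V =>
    rintro ⟨i, x⟩ ⟨j, y⟩
    simp only [Tape.lwU, Tape.sem, I.mem_iff, map_fst_eq_append, Prod.mk.injEq]
    grind
  | cobang V => simp [Tape.lwU, Tape.sem]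
  | codiag V =>
    rintro ⟨i, x⟩ ⟨j, y⟩
    simp only [Tape.lwU, Tape.sem, I.mem_iff, map_fst_eq_append, Prod.mk.injEq]
    grind
  | tr V t ih =>
    rintro ⟨i, x⟩ ⟨j, y⟩
    rw [Tape.lwU, Tape.sem_tr, Run.whisker (g := t.sem I)
      (θ := fun u a x => u.map Sigma.fst = U ∧ x = u ++ a)]
    · simp only [Tape.sem_tr]
      grind
    · rintro u u' a a' x ⟨hu, hx⟩ ⟨hu', hx'⟩
      exact append_inj_of_map_fst I (hx.symm.trans hx') hu hu'
    · rintro u a x ⟨hu, -⟩ c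
      exact ⟨_, hu, rfl⟩
    · intro x y
      rw [ih]
      grind

theorem Tape.sem_rwU (I : Interp.{u} S) (U : Mono S) (t : Tape S) : ∀ {x y},
    (Tape.rwU U t).sem I x y ↔ ∃ u a b, u.map Sigma.fst = U ∧ x.2 = a ++ u ∧ y.2 = b ++ u ∧
      t.sem I (x.1, a) (y.1, b) := by
  induction t with
  | idU V =>
    rintro ⟨i, x⟩ ⟨j, y⟩
    simp only [Tape.rwU, Tape.sem, I.mem_iff, map_fst_eq_append, Prod.mk.injEq]
    grind
  | idZero => simp [Tape.rwU, Tape.sem]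
  | circ c =>
    rintro ⟨i, x⟩ ⟨j, y⟩
    simp only [Tape.rwU, Tape.sem, Circ.sem_ten, Circ.sem_idW]
    grind
  | symm V W =>
    rintro ⟨i, x⟩ ⟨j, y⟩
    simp only [Tape.rwU, Tape.sem, I.mem_iff, map_fst_eq_append, Prod.mk.injEq]
    grind
  | seq t s ih₁ ih₂ =>
    intro x y
    simp only [Tape.rwU, Tape.sem_seq, ih₁, ih₂]
    constructor
    · rintro ⟨⟨k, z⟩, ⟨u, a, b, hu, hx, hz, h₁⟩, v, c, d, hv, hz', hy, h₂⟩
      obtain ⟨rfl, rfl⟩ := append_inj_of_map_fst' I (hz.symm.trans hz') hu hv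
      exact ⟨u, a, d, hu, hx, hy, _, h₁, h₂⟩
    · rintro ⟨u, a, d, hu, hx, hy, z, h₁, h₂⟩
      exact ⟨(z.1, z.2 ++ u), ⟨u, a, z.2, hu, hx, rfl, h₁⟩, u, z.2, d, hu, rfl, hy, h₂⟩
  | par t s ih₁ ih₂ =>
    intro x y
    simp only [Tape.rwU, Tape.sem_par, ih₁, ih₂, Tape.length_dom_rwU, Tape.length_cod_rwU]
    grind
  | bang V => simp [Tape.rwU, Tape.sem]
  | diag V =>
    rintro ⟨i, x⟩ ⟨j, y⟩
    simp only [Tape.rwU, Tape.sem, I.mem_iff, map_fst_eq_append, Prod.mk.injEq]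
    grind
  | cobang V => simp [Tape.rwU, Tape.sem]
  | codiag V =>
    rintro ⟨i, x⟩ ⟨j, y⟩
    simp only [Tape.rwU, Tape.sem, I.mem_iff, map_fst_eq_append, Prod.mk.injEq]
    grind
  | tr V t ih =>
    rintro ⟨i, x⟩ ⟨j, y⟩
    rw [Tape.rwU, Tape.sem_tr, Run.whisker (g := t.sem I)
      (θ := fun u a x => u.map Sigma.fst = U ∧ x = a ++ u)]
    · simp only [Tape.sem_tr]
      grind
    · rintro u u' a a' x ⟨hu, hx⟩ ⟨hu', hx'⟩
      exact (append_inj_of_map_fst' I (hx.symm.trans hx') hu hu').symm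
    · rintro u a x ⟨hu, -⟩ c
      exact ⟨_, hu, rfl⟩
    · intro x y
      rw [ih]
      grind

theorem Tape.sem_seq_mono (I : Interp.{u} S) {t t' s s' : Tape S}
    (ht : ∀ x y, t.sem I x y → t'.sem I x y) (hs : ∀ x y, s.sem I x y → s'.sem I x y) (x y)
    (h : (t ⨟ₜ s).sem I x y) : (t' ⨟ₜ s').sem I x y :=
  let ⟨z, h₁, h₂⟩ := h
  ⟨z, ht _ _ h₁, hs _ _ h₂⟩

theorem Tape.sem_par_mono (I : Interp.{u} S) {t t' s s' : Tape S}
    (hdom : t.dom.length = t'.dom.length) (hcod : t.cod.length = t'.cod.length)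
    (ht : ∀ x y, t.sem I x y → t'.sem I x y) (hs : ∀ x y, s.sem I x y → s'.sem I x y) (x y)
    (h : (t ⊞ₜ s).sem I x y) : (t' ⊞ₜ s').sem I x y := by
  rw [Tape.sem_par] at h ⊢
  rw [← hdom, ← hcod]
  exact h.imp (ht _ _) fun ⟨h₁, h₂, h⟩ => ⟨h₁, h₂, hs _ _ h⟩

theorem Tape.sem_lwP_mono (I : Interp.{u} S) (P : Poly S) {t t' : Tape S}
    (hdom : t.dom = t'.dom) (hcod : t.cod = t'.cod)
    (ht : ∀ x y, t.sem I x y → t'.sem I x y) :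
    ∀ x y, (Tape.lwP P t).sem I x y → (Tape.lwP P t').sem I x y := by
  induction P with
  | nil => exact fun _ _ h => h
  | cons U P ih =>
    refine Tape.sem_par_mono I (by simp only [Tape.length_dom_lwU, hdom])
      (by simp only [Tape.length_cod_lwU, hcod]) (fun x y h => ?_) ih
    obtain ⟨u, a, b, hu, hx, hy, h⟩ := (Tape.sem_lwU I U t).1 h
    exact (Tape.sem_lwU I U t').2 ⟨u, a, b, hu, hx, hy, ht _ _ h⟩

/-- The distributors depend on the tape only through `dom` and `cod`, so they coincide on both sides
and their denotation never has to be computed. -/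
theorem Tape.sem_rwP_mono (I : Interp.{u} S) (P : Poly S) {t t' : Tape S}
    (hdom : t.dom = t'.dom) (hcod : t.cod = t'.cod)
    (ht : ∀ x y, t.sem I x y → t'.sem I x y) :
    ∀ x y, (Tape.rwP P t).sem I x y → (Tape.rwP P t').sem I x y := by
  induction P with
  | nil => exact fun _ _ h => h
  | cons U P ih =>
    rw [Tape.rwP, Tape.rwP, hdom, hcod]
    refine Tape.sem_seq_mono I (Tape.sem_seq_mono I (fun _ _ h => h)
      (Tape.sem_par_mono I (by simp only [Tape.length_dom_rwU, hdom])
        (by simp only [Tape.length_cod_rwU, hcod]) (fun x y h => ?_) ih)) (fun _ _ h => h)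
    obtain ⟨u, a, b, hu, hx, hy, h⟩ := (Tape.sem_rwU I U t).1 h
    exact (Tape.sem_rwU I U t').2 ⟨u, a, b, hu, hx, hy, ht _ _ h⟩

/-! ### Tapes that only move elements between summands -/

/-- `⟦t⟧` relates `(i, a) ∈ ⟦P⟧` to `(j, b)` if and only if `ρ i j` and `a = b`. -/
def Tape.Moves (I : Interp.{u} S) (t : Tape S) (P : Poly S) (ρ : ℕ → ℕ → Prop) : Prop :=
  ∀ x y, t.sem I x y ↔ I.PMem P x ∧ ρ x.1 y.1 ∧ y.2 = x.2

namespace Tape.Moves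

variable {I : Interp.{u} S} {t s : Tape S} {P Q P' Q' : Poly S} {ρ σ : ℕ → ℕ → Prop}

theorem congr (h : t.Moves I P ρ) (hρ : ∀ i < P.length, ∀ j, ρ i j ↔ σ i j) : t.Moves I P σ := by
  intro x y
  rw [h x y]
  exact and_congr_right fun hx => and_congr_left fun _ => hρ _ hx.lt _

/-- Reduces an equation between structural tapes to a comparison of two relations on finitely many
source indices. -/
theorem sem_iff (h : t.Moves I P ρ) (h' : s.Moves I P σ)
    (hρ : ∀ i < P.length, ∀ j, ρ i j ↔ σ i j) {x y} : t.sem I x y ↔ s.sem I x y := by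
  rw [h.congr hρ x y, h' x y]

theorem sem_imp (h : t.Moves I P ρ) (h' : s.Moves I P σ)
    (hρ : ∀ i < P.length, ∀ j, ρ i j → σ i j) {x y} (hx : t.sem I x y) : s.sem I x y := by
  rw [h x y] at hx
  exact (h' x y).2 ⟨hx.1, hρ _ hx.1.lt _ hx.2.1, hx.2.2⟩

theorem seq (h : t.Moves I P ρ) (ht : t.HasType P Q) (h' : s.Moves I Q σ) :
    (t ⨟ₜ s).Moves I P (fun i j => ∃ k, ρ i k ∧ σ k j) := by
  intro x y
  rw [Tape.sem_seq]
  constructor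
  · rintro ⟨z, h₁, h₂⟩
    obtain ⟨hx, hρ, hz⟩ := (h _ _).1 h₁
    obtain ⟨-, hσ, hy⟩ := (h' _ _).1 h₂
    exact ⟨hx, ⟨_, hρ, hσ⟩, hy.trans hz⟩
  · rintro ⟨hx, ⟨k, hρ, hσ⟩, hy⟩
    have h₁ := (h x (k, x.2)).2 ⟨hx, hρ, rfl⟩
    exact ⟨(k, x.2), h₁, (h' _ _).2 ⟨(ht.sem_typed I h₁).2, hσ, hy⟩⟩

/-- The bound `i < P.length` is needed because `ρ` carries no information outside the indices of
`P`. -/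
theorem par (h : t.Moves I P ρ) (ht : t.HasType P Q) (h' : s.Moves I P' σ) :
    (t ⊞ₜ s).Moves I (P ++ P') (fun i j => i < P.length ∧ ρ i j ∨
      P.length ≤ i ∧ Q.length ≤ j ∧ σ (i - P.length) (j - Q.length)) := by
  intro x y
  rw [Tape.sem_par, h, h', I.pmem_append, ht.dom_cod.1, ht.dom_cod.2]
  have : I.PMem P x → x.1 < P.length := fun h => h.lt
  grind

theorem idU (U : Mono S) : (Tape.idU U).Moves I [U] (fun i j => j = i) := by
  rintro ⟨i, x⟩ ⟨j, y⟩
  simp only [Tape.sem, I.pmem_singleton, I.mem_iff, Prod.mk.injEq]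
  grind

theorem idZero : (Tape.idZero : Tape S).Moves I [] (fun i j => j = i) := by
  intro x y
  simp [Tape.sem, I.pmem_nil]

theorem symm (U V : Mono S) : (Tape.symm U V).Moves I [U, V] (fun i j => j = 1 - i) := by
  rintro ⟨i, x⟩ ⟨j, y⟩
  rw [show [U, V] = [U] ++ [V] from rfl, I.pmem_append]
  simp only [Tape.sem, I.pmem_singleton, I.mem_iff, Prod.mk.injEq, List.length_singleton]
  grind

theorem diag (U : Mono S) : (Tape.diag U).Moves I [U] (fun _ j => j < 2) := by
  rintro ⟨i, x⟩ ⟨j, y⟩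
  simp only [Tape.sem, I.pmem_singleton, I.mem_iff, Prod.mk.injEq]
  grind

theorem codiag (U : Mono S) : (Tape.codiag U).Moves I [U, U] (fun _ j => j = 0) := by
  rintro ⟨i, x⟩ ⟨j, y⟩
  rw [show [U, U] = [U] ++ [U] from rfl, I.pmem_append]
  simp only [Tape.sem, I.pmem_singleton, I.mem_iff, Prod.mk.injEq, List.length_singleton]
  grind

theorem bang (U : Mono S) : (Tape.bang U).Moves I [U] (fun _ _ => False) := by
  intro x y
  simp [Tape.sem]

theorem cobang (U : Mono S) : (Tape.cobang U).Moves I [] (fun _ _ => False) := by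
  intro x y
  simp [Tape.sem]

theorem idP (P : Poly S) : (Tape.idP P).Moves I P (fun i j => j = i) := by
  induction P with
  | nil => exact idZero
  | cons U P ih =>
    refine ((idU U).par (.idU U) ih).congr fun i _ j => ?_
    simp only [List.length_singleton]
    grind

theorem symmU (U : Mono S) (Q : Poly S) : (Tape.symmU U Q).Moves I (U :: Q)
    (fun i j => i = 0 ∧ j = Q.length ∨ i ≠ 0 ∧ j = i - 1) := by
  induction Q with
  | nil =>
    refine (idU U).congr fun i hi j => ?_
    simp only [List.length_singleton, List.length_nil] at hi ⊢
    grind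
  | cons V Q ih =>
    refine (((symm U V).par (.symm U V) (idP Q)).seq (Q := [V] ++ (U :: Q))
      (.par (Q₁ := [V, U]) (.symm U V) (Tape.idP_typed Q)) ((idU V).par (.idU V) ih)).congr fun i hi j => ?_
    simp only [List.length_append, List.length_cons, List.length_nil] at hi ⊢
    constructor
    · rintro ⟨k, h₁, h₂⟩
      grind
    · intro h
      -- The index after swapping the first two summands.
      refine ⟨if i < 2 then 1 - i else i, ?_, ?_⟩ <;> grind

theorem symmP (P Q : Poly S) : (Tape.symmP P Q).Moves I (P ++ Q)
    (fun i j => i < P.length ∧ j = i + Q.length ∨ P.length ≤ i ∧ j = i - P.length) := by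
  induction P with
  | nil =>
    refine (idP Q).congr fun i hi j => ?_
    simp
  | cons U P ih =>
    have hty := Tape.HasType.par (.idU U) (Tape.symmP_typed P Q)
    have h := ((symmU (I := I) U Q).par (Tape.symmU_typed U Q) (idP P))
    rw [← List.append_assoc] at hty
    refine (((idU U).par (.idU U) ih).seq hty h).congr fun i hi j => ?_
    simp only [List.length_append, List.length_cons, List.length_nil] at hi ⊢
    constructor
    · rintro ⟨k, h₁, h₂⟩
      grind
    · intro h
      -- The index after the inductive symmetry: `U` stays in front, `P` moves right past `Q`, and
      -- `Q` moves left past `P`.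
      refine ⟨if i < 1 then i else if i < P.length + 1 then i + Q.length else i - P.length,
        ?_, ?_⟩ <;> grind

end Tape.Moves

/-! ### Soundness of the axioms for tapes -/

theorem Tape.sem_idP (I : Interp.{u} S) {P : Poly S} {x y} :
    (Tape.idP P).sem I x y ↔ I.PMem P x ∧ y = x := by
  rw [Tape.Moves.idP P x y, Prod.ext_iff]

theorem Tape.sem_par_of_typed (I : Interp.{u} S) {t s : Tape S} {P Q : Poly S}
    (ht : t.HasType P Q) {x y} : (t ⊞ₜ s).sem I x y ↔ t.sem I x y ∨ P.length ≤ x.1 ∧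
      Q.length ≤ y.1 ∧ s.sem I (x.1 - P.length, x.2) (y.1 - Q.length, y.2) := by
  rw [Tape.sem_par, ht.dom_cod.1, ht.dom_cod.2]

theorem Tape.sem_par_idP (I : Interp.{u} S) {t : Tape S} {P Q R : Poly S}
    (ht : t.HasType P Q) {x y} :
    (t ⊞ₜ Tape.idP R).sem I x y ↔ Run.ParId P.length Q.length (t.sem I) (I.PMem R) x y := by
  rw [Tape.sem_par_of_typed I ht, Tape.sem_idP]
  refine or_congr Iff.rfl ⟨?_, ?_⟩
  · rintro ⟨h₁, h₂, h, h'⟩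
    simp only [Prod.mk.injEq] at h'
    refine ⟨_, _, ?_, ?_, h⟩ <;> ext1
    · simp only; omega
    · rfl
    · simp only; omega
    · exact h'.2
  · rintro ⟨i, a, rfl, rfl, h⟩
    simpa using h

theorem Tape.trP_append (P R : Poly S) (t : Tape S) :
    Tape.trP R (Tape.trP P t) = Tape.trP (P ++ R) t := by
  induction P generalizing t with
  | nil => rfl
  | cons U P ih => exact ih _

theorem Tape.sem_uniformity_right (I : Interp.{u} S) {t₁ t₂ s₁ s₂ : Tape S} {R₁ R₂ P Q : Poly S}
    (ht₁ : t₁.HasType (R₁ ++ P) (R₁ ++ Q)) (hs₁ : s₁.HasType R₁ R₂) (hs₂ : s₂.HasType R₁ R₂)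
    (hs : ∀ x y, s₂.sem I x y → s₁.sem I x y)
    (h : ∀ x y, (t₁ ⨟ₜ (s₁ ⊞ₜ Tape.idP Q)).sem I x y → ((s₂ ⊞ₜ Tape.idP P) ⨟ₜ t₂).sem I x y)
    {x y} (hx : (Tape.trP R₁ t₁).sem I x y) : (Tape.trP R₂ t₂).sem I x y := by
  rw [Tape.sem_trP] at hx ⊢
  refine Run.uniformity_right (s₁ := s₁.sem I) (s₂ := s₂.sem I) (M := I.PMem P) (N := I.PMem Q)
    hs (fun x y h => ?_) (fun x j b h => ?_) (fun x z y hf hz => ?_) hx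
  · exact ⟨(hs₂.sem_typed I h).1.lt, (hs₂.sem_typed I h).2.lt⟩
  · have := (ht₁.sem_typed I h).2
    rwa [add_comm, I.pmem_append_shift] at this
  · obtain ⟨w, hw, hg⟩ := h x y ⟨z, hf, (Tape.sem_par_idP I hs₁).2 hz⟩
    exact ⟨w, (Tape.sem_par_idP I hs₂).1 hw, hg⟩

theorem Tape.sem_uniformity_left (I : Interp.{u} S) {t₁ t₂ s₁ s₂ : Tape S} {R₁ R₂ P Q : Poly S}
    (ht₁ : t₁.HasType (R₁ ++ P) (R₁ ++ Q)) (hs₁ : s₁.HasType R₂ R₁) (hs₂ : s₂.HasType R₂ R₁)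
    (hs : ∀ x y, s₂.sem I x y → s₁.sem I x y)
    (h : ∀ x y, ((s₁ ⊞ₜ Tape.idP P) ⨟ₜ t₁).sem I x y → (t₂ ⨟ₜ (s₂ ⊞ₜ Tape.idP Q)).sem I x y)
    {x y} (hx : (Tape.trP R₁ t₁).sem I x y) : (Tape.trP R₂ t₂).sem I x y := by
  rw [Tape.sem_trP] at hx ⊢
  refine Run.uniformity_left (s₁ := s₁.sem I) (s₂ := s₂.sem I) (M := I.PMem P) (N := I.PMem Q)
    hs (fun x y h => ?_) (fun i a z h => ?_) (fun x z y hz hf => ?_) hx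
  · exact ⟨(hs₂.sem_typed I h).1.lt, (hs₂.sem_typed I h).2.lt⟩
  · have := (ht₁.sem_typed I h).1
    rwa [add_comm, I.pmem_append_shift] at this
  · obtain ⟨w, hg, hw⟩ := h x y ⟨z, (Tape.sem_par_idP I hs₁).2 hz, hf⟩
    exact ⟨w, hg, (Tape.sem_par_idP I hs₂).1 hw⟩

theorem Tape.sem_interchange (I : Interp.{u} S) {f₁ f₂ g₁ g₂ : Tape S}
    {P₁ Q₁ R₁ : Poly S} (hf₁ : f₁.HasType P₁ Q₁) (hg₁ : g₁.HasType Q₁ R₁)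
    {x y} :
    ((f₁ ⊞ₜ f₂) ⨟ₜ (g₁ ⊞ₜ g₂)).sem I x y ↔ ((f₁ ⨟ₜ g₁) ⊞ₜ (f₂ ⨟ₜ g₂)).sem I x y := by
  rw [Tape.sem_seq, Tape.sem_par_of_typed I (hf₁.seq hg₁)]
  simp only [Tape.sem_par_of_typed I hf₁, Tape.sem_par_of_typed I hg₁, Tape.sem_seq]
  constructor
  · rintro ⟨z, h | ⟨h₁, h₂, h⟩, h' | ⟨h₃, h₄, h'⟩⟩
    · exact .inl ⟨z, h, h'⟩
    -- In the mixed cases the middle index would lie on both sides of `Q₁.length`.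
    · exact absurd (hf₁.sem_typed I h).2.lt (by omega)
    · exact absurd (hg₁.sem_typed I h').1.lt (by omega)
    · exact .inr ⟨h₁, h₄, _, h, h'⟩
  · rintro (⟨z, h, h'⟩ | ⟨h₁, h₂, ⟨k, c⟩, h, h'⟩)
    · exact ⟨z, .inl h, .inl h'⟩
    · exact ⟨(k + Q₁.length, c), .inr ⟨h₁, by simp, by simpa using h⟩,
        .inr ⟨by simp, h₂, by simpa using h'⟩⟩

theorem Tape.sem_symm_nat (I : Interp.{u} S) {f : Tape S} {P Q R : Poly S}
    (hf : f.HasType P Q) {x y} :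
    ((f ⊞ₜ Tape.idP R) ⨟ₜ Tape.symmP Q R).sem I x y ↔
      (Tape.symmP P R ⨟ₜ (Tape.idP R ⊞ₜ f)).sem I x y := by
  have key : ∀ {z}, (Tape.symmP P R).sem I x z ↔ _ := fun {z} => Tape.Moves.symmP P R x z
  have key' : ∀ {z}, (Tape.symmP Q R).sem I z y ↔ _ := fun {z} => Tape.Moves.symmP Q R z y
  simp only [Tape.sem_seq, key, key', Tape.sem_par_of_typed I hf,
    Tape.sem_par_of_typed I (Tape.idP_typed R), Tape.sem_idP]
  obtain ⟨i, a⟩ := x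
  obtain ⟨j, b⟩ := y
  simp only [Prod.mk.injEq]
  constructor
  · rintro ⟨⟨k, c⟩, h | ⟨h₁, h₂, h₃, h₄, h₅⟩, -, h', hc⟩
    · obtain ⟨hx, hy⟩ := hf.sem_typed I h
      have hi := hx.lt
      have hk := hy.lt
      dsimp only at *
      obtain rfl : j = k + R.length := by omega
      obtain rfl : b = c := hc
      exact ⟨(i + R.length, a), ⟨hx.append_left _, .inl ⟨hi, rfl⟩, rfl⟩,
        .inr ⟨by simp, by simp, by simpa using h⟩⟩
    · have hi := h₃.lt
      dsimp only at *
      obtain rfl : j = i - P.length := by omega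
      obtain rfl : b = c := hc
      obtain rfl : b = a := h₅
      exact ⟨(i - P.length, b), ⟨I.pmem_append.2 (.inr ⟨h₁, h₃⟩), .inr ⟨h₁, rfl⟩, rfl⟩,
        .inl ⟨h₃, rfl⟩⟩
  · rintro ⟨⟨k, c⟩, ⟨hx, h, hc⟩, ⟨h₁, h₂⟩ | ⟨h₁, h₂, h₃⟩⟩
    · have hk := h₁.lt
      dsimp only at *
      obtain rfl : c = a := hc
      obtain ⟨rfl, rfl⟩ := Prod.mk.inj h₂
      have hi : P.length ≤ i := by
        by_contra hlt
        omega
      obtain rfl : j = i - P.length := by omega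
      exact ⟨(i - P.length + Q.length, b), .inr ⟨hi, by simp, by simpa using h₁⟩,
        I.pmem_append.2 (.inr (by simpa using h₁)), .inr (by simp), rfl⟩
    · obtain ⟨hx', hy⟩ := hf.sem_typed I h₃
      have hk := hx'.lt
      have hj := hy.lt
      have hi := hx.lt
      rw [List.length_append] at hi
      dsimp only at *
      obtain rfl : c = a := hc
      have hki : k - R.length = i := by omega
      rw [hki] at h₃
      refine ⟨(j - R.length, b), .inl h₃, hy.append_left _, .inl ?_, rfl⟩
      dsimp only
      omega

theorem Tape.sem_tr_iff (I : Interp.{u} S) {U : Mono S} {t : Tape S} {x y} :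
    (Tape.tr U t).sem I x y ↔ t.sem I (x.1 + 1, x.2) (y.1 + 1, y.2) ∨
      ∃ a b, t.sem I (x.1 + 1, x.2) (0, a) ∧
        Relation.ReflTransGen (fun c d => t.sem I (0, c) (0, d)) a b ∧
        t.sem I (0, b) (y.1 + 1, y.2) := Iff.rfl

theorem Tape.sem_idU_par (I : Interp.{u} S) {U : Mono S} {t : Tape S} {x y} :
    (Tape.idU U ⊞ₜ t).sem I x y ↔ (x.1 = 0 ∧ x.2.map Sigma.fst = U ∧ y = x) ∨
      1 ≤ x.1 ∧ 1 ≤ y.1 ∧ t.sem I (x.1 - 1, x.2) (y.1 - 1, y.2) := by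
  rw [Tape.sem_par_of_typed I (.idU U), Tape.sem, I.mem_iff]
  rfl

/-- The loop lives at index `0`, where `u` and `v` do not act: `u` only changes how the loop is
entered, and `v` how it is left. -/
theorem Tape.sem_tightening (I : Interp.{u} S) {U : Mono S} {u t v : Tape S} {P Q : Poly S}
    (ht : t.HasType (U :: P) (U :: Q)) {x y} :
    (Tape.tr U ((.idU U ⊞ₜ u) ⨟ₜ t ⨟ₜ (.idU U ⊞ₜ v))).sem I x y ↔
      (u ⨟ₜ .tr U t ⨟ₜ v).sem I x y := by
  -- The identity on `U` filters states by their sorts; the typing of `t` makes this filter vacuous.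
  have h₀ : ∀ {a y}, t.sem I (0, a) y → a.map Sigma.fst = U := fun h => by
    simpa [Interp.PMem, eq_comm] using (ht.sem_typed I h).1
  have h₁ : ∀ {x a}, t.sem I x (0, a) → a.map Sigma.fst = U := fun h => by
    simpa [Interp.PMem, eq_comm] using (ht.sem_typed I h).2
  have hl : ∀ {x : ℕ × I.Elt} {y}, ((Tape.idU U ⊞ₜ u) ⨟ₜ t).sem I (x.1 + 1, x.2) y ↔
      ∃ z, u.sem I x z ∧ t.sem I (z.1 + 1, z.2) y := by
    intro x y
    simp only [Tape.sem_seq, Tape.sem_idU_par]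
    constructor
    · rintro ⟨⟨k, z⟩, ⟨h, -⟩ | ⟨-, h, h'⟩, h''⟩
      · simp at h
      · exact ⟨(k - 1, z), h', by simpa [Nat.sub_add_cancel h] using h''⟩
    · rintro ⟨z, h, h'⟩
      exact ⟨(z.1 + 1, z.2), .inr ⟨by simp, by simp, h⟩, h'⟩
  have hl' : ∀ {a y}, ((Tape.idU U ⊞ₜ u) ⨟ₜ t).sem I (0, a) y ↔ t.sem I (0, a) y := by
    intro a y
    simp only [Tape.sem_seq, Tape.sem_idU_par]
    constructor
    · rintro ⟨z, ⟨-, -, rfl⟩ | ⟨h, -⟩, h'⟩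
      · exact h'
      · simp at h
    · exact fun h => ⟨(0, a), .inl ⟨trivial, h₀ h, rfl⟩, h⟩
  have hr : ∀ {s : Tape S} {x : ℕ × I.Elt} {y : ℕ × I.Elt},
      (s ⨟ₜ (Tape.idU U ⊞ₜ v)).sem I x (y.1 + 1, y.2) ↔
      ∃ z, s.sem I x (z.1 + 1, z.2) ∧ v.sem I z y := by
    intro s x y
    simp only [Tape.sem_seq, Tape.sem_idU_par]
    constructor
    · rintro ⟨⟨k, z⟩, h'', ⟨h, -, h'⟩ | ⟨h, -, h'⟩⟩
      · simp only at h
        simp [h] at h'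
      · exact ⟨(k - 1, z), by simpa [Nat.sub_add_cancel h] using h'', h'⟩
    · rintro ⟨z, h, h'⟩
      exact ⟨_, h, .inr ⟨by simp, by simp, h'⟩⟩
  have hr' : ∀ {x b}, (((Tape.idU U ⊞ₜ u) ⨟ₜ t) ⨟ₜ (Tape.idU U ⊞ₜ v)).sem I x (0, b) ↔
      ((Tape.idU U ⊞ₜ u) ⨟ₜ t).sem I x (0, b) := by
    intro x b
    rw [Tape.sem_seq]
    simp only [Tape.sem_idU_par]
    constructor
    · rintro ⟨z, h, ⟨-, -, hz⟩ | ⟨-, h', -⟩⟩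
      · rwa [hz]
      · simp at h'
    · intro h
      have ⟨z, _, h'⟩ := h
      exact ⟨_, h, .inl ⟨rfl, h₁ h', rfl⟩⟩
  rw [Tape.sem_tr_iff]
  simp only [hr, hr', hl, hl']
  simp only [Tape.sem_seq, Tape.sem_tr_iff]
  constructor
  · rintro (⟨z, ⟨w, hu, ht⟩, hv⟩ | ⟨a, b, ⟨w, hu, ht⟩, h, z, ht', hv⟩)
    · exact ⟨z, ⟨w, hu, .inl ht⟩, hv⟩
    · exact ⟨z, ⟨w, hu, .inr ⟨a, b, ht, h, ht'⟩⟩, hv⟩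
  · rintro ⟨z, ⟨w, hu, ht | ⟨a, b, ht, h, ht'⟩⟩, hv⟩
    · exact .inl ⟨z, ⟨w, hu, ht⟩, hv⟩
    · exact .inr ⟨a, b, ⟨w, hu, ht⟩, h, z, ht', hv⟩

theorem Tape.sem_strength (I : Interp.{u} S) {U : Mono S} {t s : Tape S} {P Q : Poly S}
    (ht : t.HasType (U :: P) (U :: Q)) {x y} :
    (Tape.tr U (t ⊞ₜ s)).sem I x y ↔ (Tape.tr U t ⊞ₜ s).sem I x y := by
  rw [Tape.sem_par_of_typed I (.tr ht), Tape.sem_tr_iff, Tape.sem_tr_iff]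
  simp [Tape.sem_par_of_typed I ht, or_assoc, or_comm, or_left_comm]

/-- Uniformity with both comparison tapes equal to `v`: the square to be checked is associativity.
Left uniformity gives one inclusion, right uniformity the other. -/
theorem Tape.sem_sliding (I : Interp.{u} S) {U V : Mono S} {v t : Tape S} {P Q : Poly S}
    (hv : v.HasType [U] [V]) (ht : t.HasType (V :: P) (U :: Q)) {x y} :
    (Tape.tr V (t ⨟ₜ (v ⊞ₜ Tape.idP Q))).sem I x y ↔
      (Tape.tr U ((v ⊞ₜ Tape.idP P) ⨟ₜ t)).sem I x y := by
  have h₁ : (t ⨟ₜ (v ⊞ₜ Tape.idP Q)).HasType ([V] ++ P) ([V] ++ Q) :=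
    ht.seq (.par hv (Tape.idP_typed Q))
  have h₂ : ((v ⊞ₜ Tape.idP P) ⨟ₜ t).HasType ([U] ++ P) ([U] ++ Q) :=
    (Tape.HasType.par hv (Tape.idP_typed P)).seq ht
  constructor
  · refine Tape.sem_uniformity_left I h₁ hv hv (fun _ _ h => h) ?_
    rintro x y ⟨z, h, w, h', h''⟩
    exact ⟨w, ⟨z, h, h'⟩, h''⟩
  · refine Tape.sem_uniformity_right I h₂ hv hv (fun _ _ h => h) ?_
    rintro x y ⟨w, ⟨z, h, h'⟩, h''⟩
    exact ⟨z, h, w, h', h''⟩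

theorem Tape.sem_yanking (I : Interp.{u} S) {U : Mono S} {x y} :
    (Tape.tr U (.symm U U)).sem I x y ↔ (Tape.idU U).sem I x y := by
  obtain ⟨i, a⟩ := x
  obtain ⟨j, b⟩ := y
  have : ∀ b : I.Elt, Relation.ReflTransGen (fun _ _ : I.Elt => False) a b ↔ b = a := fun b =>
    Relation.reflTransGen_iff_eq (by simp)
  simp [Tape.sem, this]
  grind

/-- The loop relation is the identity on `U`, so iterating it leads nowhere new. -/
theorem Tape.sem_trace_id (I : Interp.{u} S) {U : Mono S} {x y} :
    (Tape.tr U (.codiag U ⨟ₜ .diag U)).sem I x y ↔ (Tape.idU U).sem I x y := by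
  obtain ⟨i, a⟩ := x
  obtain ⟨j, b⟩ := y
  have : ∀ b : I.Elt, Relation.ReflTransGen (fun c d : I.Elt => I.Mem U c ∧ d = c) a b →
      b = a := fun b h => by
    induction h with
    | refl => rfl
    | tail _ h ih => exact h.2.trans ih
  simp [Tape.sem]
  grind

theorem Tape.Moves.diagP_singleton {I : Interp.{u} S} (U : Mono S) :
    (Tape.diagP [U]).Moves I [U] (fun _ j => j < 2) := by
  have h := ((Tape.Moves.diag (I := I) U).par (.diag U) .idZero).seq (Q := [U, U])
    (.par (.diag U) .idZero)
    (((Tape.Moves.idU U).par (.idU U) (.symmP [U] [])).par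
      (.par (.idU U) (Tape.symmP_typed [U] [])) (.idP []))
  refine h.congr fun i hi j => ?_
  simp only [List.length_cons, List.length_nil, List.length_append] at hi ⊢
  constructor
  · rintro ⟨k, h₁, h₂⟩
    grind
  · intro h
    exact ⟨j, by grind, by grind⟩

/-- The typings of both sides are essential: several raw axioms mention polynomials, or impose
composability, that only typing pins down. The (co)monoid laws without empty composites go through
`Tape.Moves`, where the work is to name the index in the middle of each composite. -/
theorem Tape.AxEq.sound (I : Interp.{u} S) {t s : Tape S} (h : Tape.AxEq t s) {P Q : Poly S}
    (ht : t.HasType P Q) (hs : s.HasType P Q) {x y} : t.sem I x y ↔ s.sem I x y := by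
  cases h with
  | of_circ h =>
    cases ht with | circ hc =>
    cases hs with | circ hd =>
    exact and_congr_right fun _ => and_congr_right fun _ => h.sound I hc hd
  | circ_id U =>
    obtain ⟨i, a⟩ := x
    obtain ⟨j, b⟩ := y
    simp only [Tape.sem, Circ.sem_idW, I.mem_iff, Prod.mk.injEq]
    grind
  | circ_seq c d =>
    simp only [Tape.sem, Circ.sem_seq]
    constructor
    · rintro ⟨hx, hy, z, h, h'⟩
      exact ⟨(0, z), ⟨hx, rfl, h⟩, rfl, hy, h'⟩
    · rintro ⟨z, ⟨hx, -, h⟩, -, hy, h'⟩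
      exact ⟨hx, hy, z.2, h, h'⟩
  | assoc f g h =>
    simp only [Tape.sem_seq]
    exact ⟨fun ⟨z, ⟨w, h₁, h₂⟩, h₃⟩ => ⟨w, h₁, z, h₂, h₃⟩,
      fun ⟨w, h₁, z, h₂, h₃⟩ => ⟨z, ⟨w, h₁, h₂⟩, h₃⟩⟩
  | id_seq R =>
    have hR : R = P := by rw [← ht.dom_cod.1, Tape.dom, (Tape.idP_typed R).dom_cod.1]
    subst hR
    simp only [Tape.sem_seq, Tape.sem_idP]
    constructor
    · rintro ⟨z, ⟨-, rfl⟩, h⟩; exact h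
    · intro h; exact ⟨x, ⟨(hs.sem_typed I h).1, rfl⟩, h⟩
  | seq_id _ R =>
    have hR : R = Q := by rw [← ht.dom_cod.2, Tape.cod, (Tape.idP_typed R).dom_cod.2]
    subst hR
    simp only [Tape.sem_seq, Tape.sem_idP]
    constructor
    · rintro ⟨z, h, -, rfl⟩; exact h
    · intro h; exact ⟨y, h, (hs.sem_typed I h).2, rfl⟩
  | interchange f₁ f₂ g₁ g₂ =>
    cases hs with | par h₁ h₂ =>
    cases h₁ with | seq hf hg =>
    exact Tape.sem_interchange I hf hg
  | zero_par f =>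
    rw [Tape.sem_par_of_typed I .idZero]
    simp [Tape.sem]
  | par_zero f => simp [Tape.sem]
  | par_assoc f g h =>
    simp only [Tape.sem_par, Tape.dom, Tape.cod, List.length_append, Nat.sub_sub]
    grind
  | symm_inv U V =>
    refine ((Tape.Moves.symm U V).seq (.symm U V) (Tape.Moves.symm V U)).sem_iff
      ((Tape.Moves.idU U).par (.idU U) (.idU V)) fun i hi j => ?_
    simp only [List.length_cons, List.length_nil] at hi ⊢
    grind
  | symm_nat f P Q R hf => exact Tape.sem_symm_nat I hf
  | tightening U u t v =>
    cases hs with | seq h _ =>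
    cases h with | seq _ h =>
    cases h with | tr h =>
    exact Tape.sem_tightening I h
  | strength U t s =>
    cases hs with | par h _ =>
    cases h with | tr h =>
    exact Tape.sem_strength I h
  | joining P R t => rw [Tape.trP_append]
  | vanishing t => rfl
  | sliding U V u t P' Q' hu =>
    cases hs with | tr h =>
    cases h with | seq h _ =>
    have hP : P' = P := by
      simpa [Tape.dom, hu.dom_cod.1, (Tape.idP_typed P').dom_cod.1] using h.dom_cod.1
    subst hP
    cases ht with | tr h' =>
    cases h' with | seq ht h' =>
    have hd := h'.dom_cod
    simp only [Tape.dom, Tape.cod, hu.dom_cod.1, (Tape.idP_typed Q').dom_cod.1,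
      hu.dom_cod.2, (Tape.idP_typed Q').dom_cod.2] at hd
    obtain ⟨rfl, hQ⟩ := hd
    obtain rfl : Q' = Q := by simpa using hQ
    exact Tape.sem_sliding I hu ht
  | yanking U => exact Tape.sem_yanking I
  | diag_assoc U =>
    refine ((Tape.Moves.diag U).seq (.diag U)
      ((Tape.Moves.idU U).par (.idU U) (.diag U))).sem_iff
      ((Tape.Moves.diag U).seq (.diag U)
        ((Tape.Moves.diag U).par (.diag U) (.idU U))) fun i hi j => ?_
    simp only [List.length_cons, List.length_nil] at hi ⊢
    constructor
    · rintro ⟨k, h₁, h₂⟩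
      -- Truncated subtraction is intended: outputs `0` and `1` come from the first copy, output `2`
      -- from the second.
      exact ⟨j - 1, by omega, by omega⟩
    · rintro ⟨k, h₁, h₂⟩
      exact ⟨if j = 0 then 0 else 1, by grind, by grind⟩
  | diag_unit U =>
    refine ((Tape.Moves.diag U).seq (.diag U)
      ((Tape.Moves.bang U).par (.bang U) (.idU U))).sem_iff (.idU U) fun i hi j => ?_
    simp only [List.length_cons, List.length_nil, and_false, false_or] at hi ⊢
    constructor
    · rintro ⟨k, h₁, h₂⟩
      omega
    · intro h
      exact ⟨1, by omega, by omega⟩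
  | diag_comm U =>
    refine ((Tape.Moves.diag U).seq (.diag U) (.symm U U)).sem_iff (.diag U) fun i hi j => ?_
    constructor
    · rintro ⟨k, h₁, h₂⟩
      omega
    · intro h
      exact ⟨1 - j, by omega, by omega⟩
  | codiag_assoc U =>
    refine (((Tape.Moves.idU U).par (.idU U) (.codiag U)).seq (.par (.idU U) (.codiag U))
        (.codiag U)).sem_iff
      (((Tape.Moves.codiag U).par (.codiag U) (.idU U)).seq (.par (.codiag U) (.idU U))
        (.codiag U)) fun i hi j => ?_
    simp only [List.length_cons, List.length_nil, List.length_append] at hi ⊢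
    constructor
    · rintro ⟨k, h₁, h₂⟩
      exact ⟨if i < 2 then 0 else 1, by grind, by grind⟩
    · rintro ⟨k, h₁, h₂⟩
      exact ⟨if i = 0 then 0 else 1, by grind, by grind⟩
  | codiag_unit U =>
    refine (((Tape.Moves.cobang U).par (.cobang U) (.idU U)).seq (.par (.cobang U) (.idU U))
        (.codiag U)).sem_iff (.idU U) fun i hi j => ?_
    simp only [List.length_cons, List.length_nil, List.length_append] at hi ⊢
    constructor
    · rintro ⟨k, h₁, h₂⟩
      omega
    · intro h
      exact ⟨1, by omega, by omega⟩
  | codiag_comm U =>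
    refine ((Tape.Moves.symm U U).seq (.symm U U) (.codiag U)).sem_iff (.codiag U)
      fun i hi j => ?_
    constructor
    · rintro ⟨k, h₁, h₂⟩
      omega
    · intro h
      exact ⟨1 - i, by omega, by omega⟩
  | codiag_diag U =>
    obtain ⟨i, a⟩ := x
    obtain ⟨j, b⟩ := y
    -- The target lists the two summands twice in order, so `i` goes to `i` and to `i + 2`.
    have h : (Tape.diagP [U, U]).Moves I [U, U] (fun i j => j < 4 ∧ j % 2 = i) := by
      have h := ((Tape.Moves.diag (I := I) U).par (.diag U) (Tape.Moves.diagP_singleton U)).seq (Q := [U, U, U, U])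
        (.par (.diag U) (Tape.diagP_typed [U]))
        (((Tape.Moves.idU U).par (.idU U) (.symmP [U] [U])).par
          (.par (.idU U) (Tape.symmP_typed [U] [U])) (.idP [U]))
      refine h.congr fun i hi j => ?_
      simp only [List.length_cons, List.length_nil] at hi ⊢
      constructor
      · rintro ⟨k, h₁, h₂⟩
        grind
      · intro h
        -- The index before the two middle summands are exchanged, when the copies of each summand
        -- are still adjacent.
        exact ⟨if i = 0 then if j = 0 then 0 else 1 else if j = 1 then 2 else 3,
          by grind, by grind⟩
    refine ((Tape.Moves.codiag U).seq (.codiag U) (.diag U)).sem_iff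
      (h.seq (Tape.diagP_typed [U, U]) ((Tape.Moves.codiag U).par (.codiag U) (.codiag U)))
        fun i hi j => ?_
    simp only [List.length_cons, List.length_nil] at hi ⊢
    constructor
    · rintro ⟨k, h₁, h₂⟩
      -- The summand `i` inside the `j`-th copy of `U ⊕ U`.
      exact ⟨2 * j + i, by omega, by omega⟩
    · rintro ⟨k, h₁, h₂⟩
      exact ⟨0, by omega, by omega⟩
  | cobang_bang U => simp [Tape.sem]
  | cobang_diag U => simp [Tape.sem, Tape.cobangP]
  | codiag_bang U => simp [Tape.sem, Tape.bangP]
  | bang_nat c U V => simp [Tape.sem]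
  | diag_nat c U V =>
    cases ht with | seq hc hd =>
    cases hc with | circ hc =>
    cases hd
    cases hs with | seq hd _ =>
    cases hd
    simp only [Tape.sem_seq, Tape.sem_par_of_typed I (.circ hc)]
    simp only [Tape.sem, I.mem_iff]
    have := fun {a b} => hc.sem_typed I (x := a) (y := b)
    obtain ⟨i, a⟩ := x
    obtain ⟨j, b⟩ := y
    simp only [Prod.mk.injEq, List.length_singleton]
    constructor
    · rintro ⟨⟨k, z⟩, ⟨rfl, -, h⟩, -, -, ⟨rfl, rfl⟩ | ⟨rfl, rfl⟩⟩
      · exact ⟨(0, a), ⟨rfl, (this h).1, .inl rfl⟩, .inl ⟨rfl, rfl, h⟩⟩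
      · exact ⟨(1, a), ⟨rfl, (this h).1, .inr rfl⟩, .inr ⟨le_rfl, le_rfl, rfl, rfl, h⟩⟩
    · rintro ⟨⟨k, z⟩, ⟨rfl, -, ⟨rfl, rfl⟩ | ⟨rfl, rfl⟩⟩, ⟨h₁, h₂, h⟩ | ⟨h₁, h₂, h₃, h₄, h⟩⟩
      · exact ⟨(0, b), ⟨rfl, rfl, h⟩, rfl, (this h).2, .inl ⟨h₂, rfl⟩⟩
      · exact absurd h₁ (by simp)
      · exact absurd h₁ (by simp)
      · exact ⟨(0, b), ⟨rfl, rfl, h⟩, rfl, (this h).2, .inr ⟨by omega, rfl⟩⟩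
  | cobang_nat c U V => simp [Tape.sem]
  | codiag_nat c U V =>
    cases ht with | seq hd hc =>
    cases hc with | circ hc =>
    cases hd
    cases hs with | seq _ hd =>
    cases hd
    simp only [Tape.sem_seq, Tape.sem_par_of_typed I (.circ hc)]
    simp only [Tape.sem, I.mem_iff]
    have := fun {a b} => hc.sem_typed I (x := a) (y := b)
    obtain ⟨i, a⟩ := x
    obtain ⟨j, b⟩ := y
    simp only [Prod.mk.injEq, List.length_singleton]
    constructor
    · rintro ⟨⟨k, z⟩, ⟨rfl | rfl, -, rfl, rfl⟩, -, rfl, h⟩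
      · exact ⟨(0, b), .inl ⟨rfl, rfl, h⟩, .inl rfl, (this h).2, rfl, rfl⟩
      · exact ⟨(1, b), .inr ⟨le_rfl, le_rfl, rfl, rfl, h⟩, .inr rfl, (this h).2, rfl, rfl⟩
    · rintro ⟨⟨k, z⟩, ⟨rfl, rfl, h⟩ | ⟨h₁, h₂, h₃, h₄, h⟩, -, -, rfl, rfl⟩
      · exact ⟨(0, a), ⟨.inl rfl, (this h).1, rfl⟩, rfl, rfl, h⟩
      · exact ⟨(0, a), ⟨.inr (by omega), (this h).1, rfl⟩, rfl, rfl, h⟩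
  | trace_id U => exact Tape.sem_trace_id I

theorem Tape.AxLe.sound (I : Interp.{u} S) {t s : Tape S} (h : Tape.AxLe t s) {x y}
    (hx : t.sem I x y) : s.sem I x y := by
  cases h with
  | of_circ h => exact ⟨hx.1, hx.2.1, h.sound I hx.2.2⟩
  | diag_codiag U =>
    refine ((Tape.Moves.diag U).seq (.diag U) (.codiag U)).sem_imp (.idU U) (fun i hi j => ?_) hx
    simp only [List.length_singleton] at hi
    rintro ⟨k, h₁, h₂⟩
    omega
  | codiag_diag U =>
    refine ((Tape.Moves.idU U).par (.idU U) (.idU U)).sem_imp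
      ((Tape.Moves.codiag U).seq (.codiag U) (.diag U)) (fun i hi j => ?_) hx
    simp only [List.length_singleton, List.length_append] at hi ⊢
    intro h
    exact ⟨0, rfl, by omega⟩
  | bang_cobang U => simp [Tape.sem] at hx
  | cobang_bang U => simp [Tape.sem] at hx

theorem Tape.KC.sound (I : Interp.{u} S) {t s : Tape S} (h : Tape.KC t s) {P Q : Poly S}
    (ht : t.HasType P Q) (hs : s.HasType P Q) {x y} (hx : t.sem I x y) : s.sem I x y := by
  rcases h with h | h | h
  · exact (h.sound I ht hs).1 hx
  · exact (h.sound I hs ht).2 hx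
  · exact h.sound I hx

/-- An interpretation is a model as soon as it satisfies the axioms of the theory. -/
theorem Interp.isModel_of_ax (I : Interp.{u} S) (T : Theory S)
    (hT : ∀ t s, T.ax t s → ∀ x y, t.sem I x y → s.sem I x y) : I.IsModel T := by
  intro P Q t s h
  induction h with
  | ax h ht hs =>
    intro x y hx
    exact h.elim (fun h => h.sound I ht hs hx) (fun h => hT _ _ h _ _ hx)
  | refl _ => exact fun _ _ h => h
  | trans _ _ ih₁ ih₂ => exact fun _ _ h => ih₂ _ _ (ih₁ _ _ h)
  | seq _ _ ih₁ ih₂ => exact Tape.sem_seq_mono I ih₁ ih₂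
  | par h _ ih₁ ih₂ =>
    exact Tape.sem_par_mono I (by rw [h.typed.1.dom_cod.1, h.typed.2.dom_cod.1])
      (by rw [h.typed.1.dom_cod.2, h.typed.2.dom_cod.2]) ih₁ ih₂
  | ten h h' ih₁ ih₂ =>
    -- Once typed, both products whisker by the same polynomials, so monotonicity of the two
    -- whiskerings suffices.
    rw [Tape.ten, Tape.ten, h.typed.1.dom_cod.1, h.typed.2.dom_cod.1, h'.typed.1.dom_cod.2,
      h'.typed.2.dom_cod.2]
    exact Tape.sem_seq_mono I
      (Tape.sem_lwP_mono I _ (by rw [h'.typed.1.dom_cod.1, h'.typed.2.dom_cod.1])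
        (by rw [h'.typed.1.dom_cod.2, h'.typed.2.dom_cod.2]) ih₂)
      (Tape.sem_rwP_mono I _ (by rw [h.typed.1.dom_cod.1, h.typed.2.dom_cod.1])
        (by rw [h.typed.1.dom_cod.2, h.typed.2.dom_cod.2]) ih₁)
  | unif_r h₁ _ hs _ ih₁ ih₂ =>
    exact fun _ _ => Tape.sem_uniformity_right I h₁ hs.typed.2 hs.typed.1 ih₁ ih₂
  | unif_l h₁ _ hs _ ih₁ ih₂ =>
    exact fun _ _ => Tape.sem_uniformity_left I h₁ hs.typed.2 hs.typed.1 ih₁ ih₂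

/-! ### The Kleene star -/

theorem Tape.sem_circ (I : Interp.{u} S) {c : Circ S} {x y} :
    (Tape.circ c).sem I x y ↔ x.1 = 0 ∧ y.1 = 0 ∧ c.sem I x.2 y.2 := Iff.rfl

/-- In the traced tape, index `1` is the entry and acts as the identity, index `0` is the loop and
applies `c`; either way the result may go back into the loop or leave. A run therefore performs any
finite number of `c`-steps, possibly none. -/
theorem Tape.sem_star_circ (I : Interp.{u} S) {U : Mono S} {c : Circ S} (hc : c.HasType U U)
    {x y} : (Tape.star [U] (.circ c)).sem I x y ↔ x.1 = 0 ∧ y.1 = 0 ∧ x.2.map Sigma.fst = U ∧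
      Relation.ReflTransGen (c.sem I) x.2 y.2 := by
  have hco : (Tape.codiagP [U]).Moves I [U, U] (fun _ j => j = 0) := by
    have h := (((Tape.Moves.idU U).par (.idU U) (.symmP (I := I) [] [U])).par
      (.par (.idU U) (Tape.symmP_typed [] [U])) (.idP [])).seq (Q := [U, U])
      (.par (.par (.idU U) (Tape.symmP_typed [] [U])) .idZero)
      ((Tape.Moves.codiag U).par (.codiag U) .idZero)
    refine h.congr fun i hi j => ?_
    simp only [List.length_cons, List.length_nil, List.length_append] at hi ⊢
    constructor
    · rintro ⟨k, h₁, h₂⟩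
      grind
    · intro h
      exact ⟨i, by grind, by grind⟩
  have hc' : ∀ {p q}, (Tape.codiagP [U]).sem I p q ↔ _ := fun {p q} => hco p q
  have hd : ∀ {p q}, (Tape.diagP [U]).sem I p q ↔ _ := fun {p q} =>
    Tape.Moves.diagP_singleton U p q
  have hf : ∀ {p q}, ((Tape.circ c ⊞ₜ Tape.idP [U]) ⨟ₜ Tape.codiagP [U] ⨟ₜ
      Tape.diagP [U]).sem I p q ↔ q.1 < 2 ∧ q.2.map Sigma.fst = U ∧
        (p.1 = 0 ∧ c.sem I p.2 q.2 ∨ p.1 = 1 ∧ q.2 = p.2) := by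
    intro p q
    obtain ⟨i, a⟩ := p
    obtain ⟨j, b⟩ := q
    simp only [Tape.sem_seq, hc', hd, Tape.sem_par_of_typed I (.circ hc), Tape.sem_idP,
      Tape.sem_circ, I.pmem_singleton, List.length_singleton]
    constructor
    · rintro ⟨⟨k, w⟩, ⟨⟨l, z⟩, hz, hU, hk, hw⟩, ⟨-, hw'⟩, hj, hb⟩
      dsimp only at *
      subst hw hb
      refine ⟨hj, hw', ?_⟩
      rcases hz with ⟨h₁, -, h⟩ | ⟨h₁, h₂, ⟨h₃, h₄⟩, h⟩
      · exact .inl ⟨h₁, h⟩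
      · exact .inr ⟨by omega, (Prod.mk.inj h).2⟩
    · rintro ⟨hj, hb, ⟨rfl, h⟩ | ⟨rfl, rfl⟩⟩
      · exact ⟨(0, b), ⟨(0, b), .inl ⟨rfl, rfl, h⟩,
          (I.pmem_singleton.2 ⟨rfl, hb⟩ : I.PMem [U] (0, b)).append_left [U], rfl, rfl⟩,
          ⟨rfl, hb⟩, hj, rfl⟩
      · exact ⟨(0, b), ⟨(1, b), .inr ⟨le_rfl, le_rfl, ⟨rfl, hb⟩, rfl⟩,
          (I.pmem_append_shift (P := [U])).2 (I.pmem_singleton.2 ⟨rfl, hb⟩), rfl, rfl⟩,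
          ⟨rfl, hb⟩, hj, rfl⟩
  have hr : (fun a b : I.Elt => ((Tape.circ c ⊞ₜ Tape.idP [U]) ⨟ₜ Tape.codiagP [U] ⨟ₜ
      Tape.diagP [U]).sem I (0, a) (0, b)) = c.sem I := by
    funext a b
    simp only [hf]
    simpa using fun h => (hc.sem_typed I h).2
  rw [Tape.star, Tape.trP, Tape.trP, Tape.sem_tr_iff, hr]
  simp only [hf]
  obtain ⟨i, a⟩ := x
  obtain ⟨j, b⟩ := y
  constructor
  · rintro (⟨h₁, h₂, ⟨h₃, -⟩ | ⟨h₃, h₄⟩⟩ | ⟨z, w, ⟨-, h₂, ⟨h₃, -⟩ | ⟨h₃, h₄⟩⟩, h, h₅, h₆, h₇⟩)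
    · simp at h₃
    · dsimp only at *
      subst h₄
      exact ⟨by omega, by omega, h₂, .refl⟩
    · simp at h₃
    · dsimp only at *
      subst h₄
      refine ⟨by omega, by omega, h₂, ?_⟩
      rcases h₇ with ⟨-, h₇⟩ | ⟨h₇, -⟩
      · exact h.tail h₇
      · simp at h₇
  · rintro ⟨rfl, rfl, ha, h⟩
    -- Leaving from the loop itself applies `c`, so the last step of the path is the exit and only
    -- the earlier ones are loop steps.
    rcases Relation.ReflTransGen.cases_tail h with rfl | ⟨w, h, h'⟩
    · exact .inl ⟨by simp, ha, .inr ⟨rfl, rfl⟩⟩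
    · exact .inr ⟨a, w, ⟨by simp, ha, .inr ⟨rfl, rfl⟩⟩, h, by simp, (hc.sem_typed I h').2,
        .inl ⟨trivial, h'⟩⟩

/-! ### The theory of Peano -/

namespace Peano

variable (I : Interp.{u} peanoSig)

/-- The element of `⟦A⟧` given by an element of the carrier. -/
def elt (x : I.carrier ()) : I.Elt := [⟨(), x⟩]

def IsZero (x : I.carrier ()) : Prop :=
  I.rel PeanoOp.zero PUnit.unit (x, PUnit.unit)

def IsSucc (x y : I.carrier ()) : Prop :=
  I.rel PeanoOp.succ (x, PUnit.unit) (y, PUnit.unit)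

theorem elt_inj {x y : I.carrier ()} : elt I x = elt I y ↔ x = y := by
  constructor
  · rintro ⟨⟩
    rfl
  · rintro rfl
    rfl

theorem map_fst_eq_A {a : I.Elt} : a.map Sigma.fst = A ↔ ∃ x, a = elt I x :=
  map_fst_eq_singleton I

theorem succC_typed : succC.HasType A A := Circ.HasType.gen (S := peanoSig) PeanoOp.succ

theorem zeroC_typed : zeroC.HasType [] A := Circ.HasType.gen (S := peanoSig) PeanoOp.zero

theorem sem_zeroC {a b : I.Elt} :
    zeroC.sem I a b ↔ a = [] ∧ ∃ x, b = elt I x ∧ IsZero I x := by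
  constructor
  · rintro ⟨_, w, rfl, rfl, h⟩
    exact ⟨rfl, w.1, rfl, h⟩
  · rintro ⟨rfl, x, rfl, h⟩
    exact ⟨PUnit.unit, (x, PUnit.unit), rfl, rfl, h⟩

theorem sem_succC {a b : I.Elt} :
    succC.sem I a b ↔ ∃ x y, a = elt I x ∧ b = elt I y ∧ IsSucc I x y := by
  constructor
  · rintro ⟨v, w, rfl, rfl, h⟩
    exact ⟨v.1, w.1, rfl, rfl, h⟩
  · rintro ⟨x, y, rfl, rfl, h⟩
    exact ⟨(x, PUnit.unit), (y, PUnit.unit), rfl, rfl, h⟩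

/-- The graph of `[s, 0] : A ⊕ 1 → A`. -/
def Copair (p q : ℕ × I.Elt) : Prop :=
  (∃ x y, p = (0, elt I x) ∧ q = (0, elt I y) ∧ IsSucc I x y) ∨
    ∃ y, p = (1, []) ∧ q = (0, elt I y) ∧ IsZero I y

theorem copair_succ {x y : I.carrier ()} :
    Copair I (0, elt I x) (0, elt I y) ↔ IsSucc I x y := by
  simp only [Copair, Prod.mk.injEq, elt_inj]
  grind

theorem copair_zero {y : I.carrier ()} : Copair I (1, []) (0, elt I y) ↔ IsZero I y := by
  simp only [Copair, Prod.mk.injEq, elt_inj]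
  grind

theorem sem_copair {p q} : copair.sem I p q ↔ Copair I p q := by
  obtain ⟨i, a⟩ := p
  obtain ⟨j, b⟩ := q
  have hd : ∀ {p q}, (Tape.codiag A).sem I p q ↔ _ := fun {p q} => Tape.Moves.codiag A p q
  simp only [copair, Tape.sem_seq, Tape.sem_par_of_typed I (.circ succC_typed), Tape.sem_circ,
    sem_succC, sem_zeroC, hd, Copair, Prod.mk.injEq, List.length_singleton]
  constructor
  · rintro ⟨⟨k, z⟩, ⟨h₁, -, x, y, h₂, h₃, h⟩ | ⟨h₁, -, h₂, -, h₃, x, h₄, h⟩, -, h₅, h₆⟩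
    · exact .inl ⟨x, y, ⟨h₁, h₂⟩, ⟨h₅, h₆.trans h₃⟩, h⟩
    · dsimp only at *
      exact .inr ⟨x, ⟨by omega, h₃⟩, ⟨h₅, h₆.trans h₄⟩, h⟩
  · rintro (⟨x, y, ⟨rfl, rfl⟩, ⟨rfl, rfl⟩, h⟩ | ⟨y, ⟨rfl, rfl⟩, ⟨rfl, rfl⟩, h⟩)
    · exact ⟨(0, elt I y), .inl ⟨rfl, rfl, x, y, rfl, rfl, h⟩, rfl, rfl, rfl⟩
    · exact ⟨(1, elt I y), .inr ⟨le_rfl, le_rfl, rfl, rfl, rfl, y, rfl, h⟩, rfl, rfl, rfl⟩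

theorem sem_copairOp {p q} : copairOp.sem I p q ↔ Copair I q p := by
  obtain ⟨i, a⟩ := p
  obtain ⟨j, b⟩ := q
  have hd : ∀ {p q}, (Tape.diag A).sem I p q ↔ _ := fun {p q} => Tape.Moves.diag A p q
  simp only [copairOp, Tape.sem_seq,
    Tape.sem_par_of_typed I (.circ (Circ.op_typed succC_typed)), Tape.sem_circ,
    Circ.sem_op I succC_typed, Circ.sem_op I zeroC_typed,
    sem_succC, sem_zeroC, hd, Copair, Prod.mk.injEq, List.length_singleton, I.pmem_singleton]
  constructor
  · rintro ⟨⟨k, z⟩, ⟨⟨h₁, -⟩, -, h₂⟩, ⟨-, h₃, x, y, h₄, h₅, h⟩ | ⟨-, h₃, -, h₄, h₅, x, h₆, h⟩⟩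
    · exact .inl ⟨x, y, ⟨h₃, h₄⟩, ⟨h₁, h₂.symm.trans h₅⟩, h⟩
    · dsimp only at *
      exact .inr ⟨x, ⟨by omega, h₅⟩, ⟨h₁, h₂.symm.trans h₆⟩, h⟩
  · rintro (⟨x, y, ⟨rfl, rfl⟩, ⟨rfl, rfl⟩, h⟩ | ⟨y, ⟨rfl, rfl⟩, ⟨rfl, rfl⟩, h⟩)
    · exact ⟨(0, elt I y), ⟨⟨rfl, rfl⟩, by simp, rfl⟩, .inl ⟨rfl, rfl, x, y, rfl, rfl, h⟩⟩
    · exact ⟨(1, elt I y), ⟨⟨rfl, rfl⟩, by simp, rfl⟩,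
        .inr ⟨le_rfl, le_rfl, rfl, rfl, rfl, y, rfl, h⟩⟩

theorem sem_idU_A {p q} : (Tape.idU A).sem I p q ↔ ∃ x, p = (0, elt I x) ∧ q = p := by
  obtain ⟨i, a⟩ := p
  simp only [Tape.sem, I.mem_iff, map_fst_eq_A, Prod.mk.injEq]
  grind

theorem sem_idU_A_par_idU_one {p q} : (Tape.idU A ⊞ₜ Tape.idU []).sem I p q ↔
    ((∃ x, p = (0, elt I x)) ∨ p = (1, [])) ∧ q = p := by
  have hd : (Tape.idU A ⊞ₜ Tape.idU []).sem I p q ↔ _ :=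
    (Tape.Moves.idU A).par (.idU A) (.idU []) p q
  obtain ⟨i, a⟩ := p
  obtain ⟨j, b⟩ := q
  simp only [hd, I.pmem_append, I.pmem_singleton, map_fst_eq_A, List.map_eq_nil_iff,
    List.length_singleton, Prod.mk.injEq]
  grind

theorem reflTransGen_succC {x : I.carrier ()} {b : I.Elt} :
    Relation.ReflTransGen (succC.sem I) (elt I x) b ↔
      ∃ y, b = elt I y ∧ Relation.ReflTransGen (IsSucc I) x y := by
  constructor
  · intro h
    induction h with
    | refl => exact ⟨x, rfl, .refl⟩
    | tail _ h ih =>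
      obtain ⟨y, rfl, hy⟩ := ih
      obtain ⟨y', z, h₁, rfl, h⟩ := (sem_succC I).1 h
      obtain rfl := (elt_inj I).1 h₁
      exact ⟨z, rfl, hy.tail h⟩
  · rintro ⟨y, rfl, h⟩
    exact h.lift (elt I) fun a b h => (sem_succC I).2 ⟨a, b, rfl, rfl, h⟩

theorem sem_zero_star_succ {p q} : (Tape.circ zeroC ⨟ₜ Tape.star [A] (.circ succC)).sem I p q ↔
    p = (0, []) ∧ ∃ x y, q = (0, elt I y) ∧ IsZero I x ∧
      Relation.ReflTransGen (IsSucc I) x y := by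
  obtain ⟨i, a⟩ := p
  obtain ⟨j, b⟩ := q
  simp only [Tape.sem_seq, Tape.sem_star_circ I succC_typed, Tape.sem_circ, sem_zeroC,
    Prod.mk.injEq]
  constructor
  · rintro ⟨⟨k, z⟩, ⟨rfl, -, rfl, x, rfl, hx⟩, -, rfl, -, h⟩
    obtain ⟨y, rfl, hy⟩ := (reflTransGen_succC I).1 h
    exact ⟨⟨rfl, rfl⟩, x, y, ⟨rfl, rfl⟩, hx, hy⟩
  · rintro ⟨⟨rfl, rfl⟩, x, y, ⟨rfl, rfl⟩, hx, hy⟩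
    exact ⟨(0, elt I x), ⟨rfl, rfl, rfl, x, rfl, hx⟩, rfl, rfl, rfl,
      (reflTransGen_succC I).2 ⟨y, rfl, hy⟩⟩

end Peano

/-! ### The natural numbers as a model -/

open Peano

/-- By soundness only the five listed inclusions remain. The first four express that every number is
zero or a successor in exactly one way; the last is induction on the number reached. -/
theorem natInterp_isModel : natInterp.IsModel peanoTheory := by
  refine natInterp.isModel_of_ax _ fun t s h => ?_
  have hz : ∀ {y : ℕ}, IsZero natInterp y ↔ y = 0 := Iff.rfl
  have hs : ∀ {x y : ℕ}, IsSucc natInterp x y ↔ y = x + 1 := Iff.rfl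
  cases h with
  | iso₁_le =>
    rintro p q ⟨r, h₁, h₂⟩
    rw [sem_copairOp] at h₁
    rw [sem_copair] at h₂
    rw [sem_idU_A]
    rcases h₁ with ⟨x, y, rfl, rfl, h⟩ | ⟨y, rfl, rfl, h⟩
    · obtain ⟨x', y', h₁, rfl, h'⟩ | ⟨y', h₁, -⟩ := h₂
      · obtain rfl := (elt_inj _).1 (Prod.mk.inj h₁).2
        rw [hs.1 h, hs.1 h']
        exact ⟨_, rfl, rfl⟩
      · simp at h₁
    · obtain ⟨x', y', h₁, -⟩ | ⟨y', -, rfl, h'⟩ := h₂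
      · simp at h₁
      · rw [hz.1 h, hz.1 h']
        exact ⟨_, rfl, rfl⟩
  | iso₁_ge =>
    intro p q h
    obtain ⟨x, rfl, rfl⟩ := (sem_idU_A _).1 h
    obtain _ | n := (x : ℕ)
    · have := (copair_zero natInterp).2 (hz.2 rfl)
      exact ⟨_, (sem_copairOp _).2 this, (sem_copair _).2 this⟩
    · have := (copair_succ natInterp).2 (hs.2 (rfl : n + 1 = n + 1))
      exact ⟨_, (sem_copairOp _).2 this, (sem_copair _).2 this⟩
  | iso₂_le =>
    rintro p q ⟨r, h₁, h₂⟩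
    rw [sem_copair] at h₁
    rw [sem_copairOp] at h₂
    rw [sem_idU_A_par_idU_one]
    rcases h₁ with ⟨x, y, rfl, rfl, h⟩ | ⟨y, rfl, rfl, h⟩
    · obtain ⟨x', y', rfl, h₁, h'⟩ | ⟨y', rfl, h₁, h'⟩ := h₂
      · obtain rfl := (elt_inj _).1 (Prod.mk.inj h₁).2
        obtain rfl : x = x' := Nat.succ_injective ((hs.1 h).symm.trans (hs.1 h'))
        exact ⟨.inl ⟨_, rfl⟩, rfl⟩
      · obtain rfl := (elt_inj _).1 (Prod.mk.inj h₁).2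
        exact absurd ((hs.1 h).symm.trans (hz.1 h')) (Nat.succ_ne_zero _)
    · obtain ⟨x', y', rfl, h₁, h'⟩ | ⟨y', rfl, h₁, h'⟩ := h₂
      · obtain rfl := (elt_inj _).1 (Prod.mk.inj h₁).2
        exact absurd ((hs.1 h').symm.trans (hz.1 h)) (Nat.succ_ne_zero _)
      · exact ⟨.inr rfl, rfl⟩
  | iso₂_ge =>
    intro p q h
    obtain ⟨⟨x, rfl⟩ | rfl, rfl⟩ := (sem_idU_A_par_idU_one _).1 h
    · have := (copair_succ natInterp (x := x)).2 (hs.2 rfl)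
      exact ⟨_, (sem_copair _).2 this, (sem_copairOp _).2 this⟩
    · have := (copair_zero natInterp).2 (hz.2 rfl)
      exact ⟨_, (sem_copair _).2 this, (sem_copairOp _).2 this⟩
  | ind =>
    rintro ⟨i, a⟩ ⟨j, b⟩ ⟨h₁, h₂, n, h₃, h₄⟩
    dsimp only at h₁ h₂ h₃ h₄
    subst h₁ h₂ h₃ h₄
    refine (sem_zero_star_succ _).2 ⟨rfl, (0 : ℕ), n, rfl, hz.2 rfl, ?_⟩
    induction (n : ℕ) with
    | zero => exact .refl
    | succ n ih => exact ih.tail (hs.2 rfl)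

/-! ### Models are isomorphic to the natural numbers -/

theorem Interp.IsModel.sem_imp {T : Theory S} {I : Interp.{u} S} (hI : I.IsModel T)
    {t s : Tape S} (h : T.ax t s) {x y} (hx : t.sem I x y) : s.sem I x y := by
  obtain ⟨P, Q, ht, hs⟩ := T.typed _ _ h
  exact hI _ _ _ _ (.ax (.inr h) ht hs) _ _ hx

/-- In a model of the theory of Peano, `[s, 0]` is a bijection `A ⊕ 1 → A` and every element is
reached from zero. -/
structure Peano.IsPeano (I : Interp.{u} peanoSig) : Prop where
  exists_succ : ∀ x, ∃ y, IsSucc I x y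
  exists_zero : ∃ x, IsZero I x
  succ_unique : ∀ {x y y'}, IsSucc I x y → IsSucc I x y' → y = y'
  zero_unique : ∀ {x y}, IsZero I x → IsZero I y → x = y
  succ_inj : ∀ {x x' y}, IsSucc I x y → IsSucc I x' y → x = x'
  not_zero_succ : ∀ {x y}, IsSucc I x y → ¬ IsZero I y
  reachable : ∀ y, ∃ x, IsZero I x ∧ Relation.ReflTransGen (IsSucc I) x y

/-- For a relation `F` with converse `F°`, totality is `id ⊆ F ; F°`, single-valuedness is `F° ; F ⊆
id` and injectivity is `F ; F° ⊆ id`. Applied to `F = [s, 0]` and read on each summand of `A ⊕ 1`,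
these give all the conditions except reachability. -/
theorem Interp.IsModel.isPeano {I : Interp.{u} peanoSig} (hI : I.IsModel peanoTheory) :
    IsPeano I := by
  have total : ∀ p, ((∃ x, p = (0, elt I x)) ∨ p = (1, [])) → ∃ q, Copair I p q := by
    intro p hp
    obtain ⟨q, hq, -⟩ := hI.sem_imp Ax.iso₂_ge ((sem_idU_A_par_idU_one I).2 ⟨hp, rfl⟩)
    exact ⟨q, (sem_copair I).1 hq⟩
  have unique : ∀ {p q q'}, Copair I p q → Copair I p q' → q = q' := fun h h' => by
    have := hI.sem_imp Ax.iso₁_le ⟨_, (sem_copairOp I).2 h, (sem_copair I).2 h'⟩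
    obtain ⟨_, -, h⟩ := (sem_idU_A I).1 this
    exact h.symm
  have inj : ∀ {p p' q}, Copair I p q → Copair I p' q → p = p' := fun h h' => by
    have := hI.sem_imp Ax.iso₂_le ⟨_, (sem_copair I).2 h, (sem_copairOp I).2 h'⟩
    exact ((sem_idU_A_par_idU_one I).1 this).2.symm
  constructor
  · intro x
    obtain ⟨_, ⟨x', y, h, -, h'⟩ | ⟨_, h, -⟩⟩ := total _ (.inl ⟨x, rfl⟩)
    · obtain rfl := (elt_inj I).1 (Prod.mk.inj h).2
      exact ⟨y, h'⟩
    · simp at h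
  · obtain ⟨_, ⟨x', y, h, -⟩ | ⟨y, -, -, h⟩⟩ := total _ (.inr rfl)
    · simp at h
    · exact ⟨y, h⟩
  · intro x y y' h h'
    exact (elt_inj I).1 (Prod.mk.inj
      (unique ((copair_succ I).2 h) ((copair_succ I).2 h'))).2
  · intro y y' h h'
    exact (elt_inj I).1 (Prod.mk.inj
      (unique ((copair_zero I).2 h) ((copair_zero I).2 h'))).2
  · intro x x' y h h'
    exact (elt_inj I).1 (Prod.mk.inj (inj ((copair_succ I).2 h) ((copair_succ I).2 h'))).2
  · intro x y h h'
    -- A zero that is a successor would have preimages in both summands, with the distinct tags `0`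
    -- and `1`.
    simpa using inj ((copair_succ I).2 h) ((copair_zero I).2 h')
  · intro y
    -- The codischarger relates the empty word to every element, so the induction axiom applies to
    -- an arbitrary `y`.
    have h : (Tape.circ (.codiscard ())).sem I (0, []) (0, elt I y) := ⟨rfl, rfl, y, rfl, rfl⟩
    obtain ⟨-, x, y', h₁, hx, h⟩ := (sem_zero_star_succ I).1 (hI.sem_imp Ax.ind h)
    obtain rfl := (elt_inj I).1 (Prod.mk.inj h₁).2
    exact ⟨x, hx, h⟩

/-- Dedekind's argument: the iterates of successor at zero are distinct, since cancelling successors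
would otherwise make zero a successor, and they exhaust the carrier by reachability. -/
theorem Peano.IsPeano.nonempty_iso {I : Interp.{u} peanoSig} (hI : IsPeano I) :
    Nonempty (I.Iso natInterp) := by
  obtain ⟨z, hz⟩ := hI.exists_zero
  choose σ hσ using hI.exists_succ
  let f : ℕ → I.carrier () := fun n => σ^[n] z
  have f_succ : ∀ n, f (n + 1) = σ (f n) := fun n => Function.iterate_succ_apply' σ n z
  have hfσ : ∀ {x y}, IsSucc I x y ↔ y = σ x := fun {x y} =>
    ⟨fun h => hI.succ_unique h (hσ x), fun h => h ▸ hσ x⟩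
  have hf : Function.Bijective f := by
    constructor
    · intro m n h
      induction m generalizing n with
      | zero =>
        cases n with
        | zero => rfl
        | succ n =>
          rw [f_succ] at h
          exact absurd hz (hI.not_zero_succ (hfσ.2 h))
      | succ m ih =>
        cases n with
        | zero =>
          rw [f_succ] at h
          exact absurd hz (hI.not_zero_succ (hfσ.2 h.symm))
        | succ n =>
          rw [f_succ, f_succ] at h
          rw [ih (hI.succ_inj (hfσ.2 rfl) (hfσ.2 h))]
    · intro y
      obtain ⟨x, hx, h⟩ := hI.reachable y
      induction h with
      -- Reachability yields some zero `x`, which uniqueness identifies with the chosen `z`.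
      | refl => exact ⟨0, hI.zero_unique hz hx⟩
      | tail _ h ih =>
        obtain ⟨n, rfl⟩ := ih
        exact ⟨n + 1, by rw [f_succ, hfσ.1 h]⟩
  let e : I.carrier () ≃ ℕ := (Equiv.ofBijective f hf).symm
  have he : ∀ {x n}, e x = n ↔ x = f n := fun {x n} => by
    rw [Equiv.symm_apply_eq]
    rfl
  refine ⟨⟨fun _ => e, fun s x y => ?_⟩⟩
  cases s with
  | zero =>
    change IsZero I y.1 ↔ e y.1 = 0
    rw [he]
    exact ⟨fun h => hI.zero_unique h hz, fun h => h ▸ hz⟩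
  | succ =>
    change IsSucc I x.1 y.1 ↔ e y.1 = e x.1 + 1
    rw [he, f_succ, hfσ, ← he.1 rfl]

end KleeneCartesian

theorem mainTheorem8 :
    KleeneCartesian.natInterp.IsModel KleeneCartesian.peanoTheory ∧
      ∀ I : KleeneCartesian.Interp.{u} KleeneCartesian.peanoSig,
        I.IsModel KleeneCartesian.peanoTheory →
          Nonempty (I.Iso KleeneCartesian.natInterp) :=
  ⟨KleeneCartesian.natInterp_isModel, fun _ hI => hI.isPeano.nonempty_iso⟩
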